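/- **Setting.** Let $\mathcal H=\mathbb C^d$. A POVM on a measurable space $\mathcal X$ is a countably additive map $B\mapsto P(B)\ge 0$ from the measurable subsets to operators on $\mathcal H$ with $P(\mathcal X)=\mathbb I$. Let $f:[0,1]\to\mathbb R$ be continuous and strictly convex, continuously differentiable on $(0,1)$ (for instance continuously differentiable on $[0,1]$, or $f(x)=x\log x$), with Bregman divergence $D_f(\rho,\sigma)=\operatorname{Tr}\big(f(\rho)-f(\sigma)-f'(\sigma)(\rho-\sigma)\big)\in[0,\infty]$; at an eigenvalue $q\in\{0,1\}$ of $\sigma$ where $f'$ is infinite, the value is $\infty$ unless $\rho=\sigma=q$ on the corresponding eigenspace of $\sigma$, which then contributes $0$. For a family of states $(\rho_\theta)_{\theta\in\Theta}$, a POVM $P$ on $\mathcal X$ and an estimator $\hat\rho$ (a measurable map from $\mathcal X$ to the density operators), the risk is $R_P(\rho_\theta,\hat\rho)=\int_{\mathcal X} D_f(\rho_\theta,\hat\rho(x))\,\operatorname{Tr}[P(dx)\rho_\theta]$. A POVM $P^*$ on $\mathcal X$ is *minimax* if $$\inf_{P}\inf_{\hat\rho}\sup_\theta R_P(\rho_\theta,\hat\rho)=\inf_{\hat\rho}\sup_\theta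 R_{P^*}(\rho_\theta,\hat\rho),$$ the infimum being over all POVMs $P$ on $\mathcal X$. **Covariant estimation.** Let a compact group $G$ act continuously and transitively on a compact metrizable space $\Theta$, let $g\mapsto V_g$ be a continuous projective unitary representation of $G$ on $\mathcal H$, let $\theta_0\in\Theta$, and let $\rho_{g\theta_0}=V_g\rho_{\theta_0}V_g^\dagger$ for all $g\in G$. The outcome space is $\mathcal X=\Theta$ with its Borel sets. For $K=G$, or $K=H$ a compact subgroup of $G$, a POVM $P$ on $\Theta$ is *covariant under $K$* if $V_g^\dagger P(B)V_g=P(g^{-1}B)$ for all $g\in K$ and all Borel $B$. It has *seed* $P_0\ge 0$ (relative to $\theta_0$) if $P(B)=\int_B p(\theta)\,d\nu_K(\theta)$ for all Borel $B$, where $p(g\theta_0)=V_gP_0V_g^\dagger$ for $g\in K$ and $\nu_K$ is the $K$-invariant probability measure on the orbit $K\theta_0$ (the image of the normalized Haar measure of $K$ under $g\mapsto g\theta_0$). A finite set $S$ of unitaries on $\mathcal H$ is a *unitary 2-design* if $\frac1{|S|}\sum_{U\in S}U^{\otimes2}\rho\,U^{\dagger\otimes2}=\int_{U(d)}U^{\otimes2}\rho\,U^{\dagger\otimes2}\,dU$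 for all states $\rho$ on $\mathcal H^{\otimes 2}$ ($dU$ the normalized Haar measure). **Corollary.** Let $P_c$ be a minimax POVM on $\Theta$ that is covariant under $G$, with seed $P_0$. Let $H$ be a compact (for instance finite) subgroup of $G$ such that $\{V_h: h\in H\}$ is a unitary 2-design, and let $P_c'$ be a POVM on $\Theta$ that is covariant under $H$ and has the same seed $P_0$. Then $P_c'$ is also minimax. **Example.** Let $d=2$, let $\Theta$ be the space of pure qubit states (rank-one projections, i.e. the Bloch sphere) with $\rho_\theta=\theta$, and let $U(2)$ act by $\theta\mapsto U\theta U^\dagger$, with $V_U=U$ and $\theta_0=|0\rangle\langle0|$. Let the Pauli measurement be the POVM on $\Theta$ that gives the operator $\frac13 e$ to each of the six eigenprojections $e$ of $\sigma_x,\sigma_y,\sigma_z$. There are a finite subgroup $H\subset U(2)$ that is a unitary 2-design and a $U(2)$-covariant POVM $P_c$ with seed $2|0\rangle\langle0|$, such that $P_c$ is minimax for every $f$ as above and the Pauli measurement is covariant under $H$ with the same seed $2|0\rangle\langle0|$. In particular the Pauli measurement is minimax for every such $f$. -/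

import Mathlib

open MeasureTheory Matrix
open scoped ENNReal Kronecker ComplexOrder

namespace QEst

/-! ### States, measurements, estimators, risk -/

/-- Density operators on the Hilbert space `ℂⁿ`. -/
structure DensityMatrix (n : Type*) [Fintype n] where
  val : Matrix n n ℂ
  posSemidef : val.PosSemidef
  trace_eq_one : val.trace = 1

/-- A positive operator-valued measure on `X`: a countably additive matrix-valued function on the
measurable subsets of `X` with positive values and total mass the identity. -/
structure POVM (X : Type*) [MeasurableSpace X] (n : Type*) [Fintype n] [DecidableEq n] where
  meas : VectorMeasure X (Matrix n n ℂ)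
  nonneg : ∀ B, MeasurableSet B → (meas B).PosSemidef
  total : meas Set.univ = 1

section Born

variable {X : Type*} [MeasurableSpace X] {n : Type*} [Fintype n] [DecidableEq n]

theorem trace_mul_nonneg {A R : Matrix n n ℂ} (hA : A.PosSemidef) (hR : R.PosSemidef) :
    0 ≤ (A * R).trace.re := by
  obtain ⟨C, rfl⟩ : ∃ C : Matrix n n ℂ, R = Cᴴ * C := by
    open scoped MatrixOrder in
    exact CStarAlgebra.nonneg_iff_eq_star_mul_self.mp hR.nonneg
  rw [← mul_assoc, trace_mul_comm, ← mul_assoc]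
  have h : (C * A * Cᴴ).PosSemidef := hA.mul_mul_conjTranspose_same C
  exact (Complex.le_def.mp h.trace_nonneg).1

/-- The real number `Tr P(B)ρ` as a signed measure in `B`. -/
noncomputable def bornSigned (P : POVM X n) (ρ : DensityMatrix n) : SignedMeasure X :=
  P.meas.mapRange
    (AddMonoidHom.mk' (fun A : Matrix n n ℂ => (A * ρ.val).trace.re)
      (fun A B => by simp [add_mul, trace_add]))
    (by
      change Continuous fun A : Matrix n n ℂ => (A * ρ.val).trace.re
      fun_prop)

theorem bornSigned_apply (P : POVM X n) (ρ : DensityMatrix n) (B : Set X) :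
    bornSigned P ρ B = (P.meas B * ρ.val).trace.re := rfl

theorem bornSigned_nonneg (P : POVM X n) (ρ : DensityMatrix n) :
    0 ≤[Set.univ] bornSigned P ρ := by
  rw [VectorMeasure.restrict_univ, VectorMeasure.restrict_univ]
  intro B hB
  exact trace_mul_nonneg (P.nonneg B hB) ρ.posSemidef

/-- Born's rule: the distribution `B ↦ Tr P(B)ρ` of the outcome of the measurement `P`
in the state `ρ`. -/
noncomputable def born (P : POVM X n) (ρ : DensityMatrix n) : Measure X :=
  (bornSigned P ρ).toMeasureOfZeroLE Set.univ MeasurableSet.univ (bornSigned_nonneg P ρ)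

theorem born_apply (P : POVM X n) (ρ : DensityMatrix n) {B : Set X} (hB : MeasurableSet B) :
    born P ρ B = ENNReal.ofReal (P.meas B * ρ.val).trace.re := by
  rw [born, SignedMeasure.toMeasureOfZeroLE_apply _ _ MeasurableSet.univ hB, ENNReal.ofReal]
  congr 1
  ext
  rw [Real.coe_toNNReal _ (trace_mul_nonneg (P.nonneg B hB) ρ.posSemidef)]
  simp [bornSigned_apply]

end Born

/-- An estimator: a measurable map from outcomes to states. -/
structure Estimator (X : Type*) [MeasurableSpace X] (n : Type*) [Fintype n] where
  toFun : X → DensityMatrix n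
  measurable_entry : ∀ i j, Measurable fun x => (toFun x).val i j

/-- The functions generating a Bregman divergence: `f` is strictly convex and continuous on `[0,1]`
and continuously differentiable on `(0,1)`. The one-sided derivatives at the end points may be
finite (`f` is then `C¹` on `[0,1]`) or infinite (as for `x log x` at `0`). -/
structure IsBregmanGenerator (f : ℝ → ℝ) : Prop where
  strictConvexOn : StrictConvexOn ℝ (Set.Icc 0 1) f
  continuousOn : ContinuousOn f (Set.Icc 0 1)
  contDiffOn : ContDiffOn ℝ 1 f (Set.Ioo 0 1)

open Classical in
/-- The Bregman divergence `D_f(ρ, σ) = Tr (f(ρ) - f(σ) - f'(σ)(ρ - σ)) ∈ [0, ∞]`.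
If `f` is `C¹` on `[0,1]` then the first case always applies. In general an eigenvalue `q ∈ {0,1}`
of `σ` at which `f'` is infinite gives, as usual, the value `∞`, unless `ρ` and `σ` agree on the
eigenspace of `σ` for `q`; in that case this eigenspace contributes nothing. -/
noncomputable def bregman {n : Type*} [Fintype n] [DecidableEq n] (f : ℝ → ℝ)
    (ρ σ : DensityMatrix n) : ℝ≥0∞ :=
  if ∀ q : ℝ, ¬ DifferentiableWithinAt ℝ f (Set.Icc 0 1) q →
      ∀ v : n → ℂ, σ.val *ᵥ v = (q : ℂ) • v → ρ.val *ᵥ v = (q : ℂ) • v then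
    ENNReal.ofReal
      (cfc f ρ.val - cfc f σ.val
        - cfc (derivWithin f (Set.Icc 0 1)) σ.val * (ρ.val - σ.val)).trace.re
  else ⊤

section Risk

variable {X : Type*} [MeasurableSpace X] {n : Type*} [Fintype n] [DecidableEq n]

/-- The risk `R_P(ρ, ρ̂)`: the expected loss when the true state is `ρ`. -/
noncomputable def risk (f : ℝ → ℝ) (P : POVM X n) (ρ : DensityMatrix n) (e : Estimator X n) :
    ℝ≥0∞ :=
  ∫⁻ x, bregman f ρ (e.toFun x) ∂(born P ρ)

/-- The minimax risk `inf_ρ̂ sup_θ R_P(ρ_θ, ρ̂)` of the measurement `P` for the family `ρ_θ`. -/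
noncomputable def minimaxRisk {Θ : Type*} (f : ℝ → ℝ) (ρ : Θ → DensityMatrix n) (P : POVM X n) :
    ℝ≥0∞ :=
  ⨅ e : Estimator X n, ⨆ θ, risk f P (ρ θ) e

/-- `P` minimizes the minimax risk among all measurements with the same outcome space. -/
def IsMinimax {Θ : Type*} (f : ℝ → ℝ) (ρ : Θ → DensityMatrix n) (P : POVM X n) : Prop :=
  ⨅ Q : POVM X n, minimaxRisk f ρ Q = minimaxRisk f ρ P

end Risk

/-! ### Projective representations, covariance, seeds -/

/-- The normalized Haar measure of a compact group. -/
noncomputable def haarProb (G : Type*) [Group G] [TopologicalSpace G] [IsTopologicalGroup G]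
    [CompactSpace G] [MeasurableSpace G] [BorelSpace G] : Measure G :=
  Measure.haarMeasure ⊤

/-- A continuous projective unitary representation `g ↦ V_g` on `ℂⁿ`: multiplicative up to phases,
and continuous modulo phases, i.e. `g ↦ V_g A V_g†` is continuous for every operator `A`. -/
structure ProjRep (G : Type*) [Group G] [TopologicalSpace G]
    (n : Type*) [Fintype n] [DecidableEq n] where
  toFun : G → unitaryGroup n ℂ
  map_mul : ∀ g h, ∃ c : ℂ, ‖c‖ = 1 ∧
    (toFun (g * h) : Matrix n n ℂ) = c • ((toFun g : Matrix n n ℂ) * (toFun h : Matrix n n ℂ))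
  continuous_conj : ∀ A : Matrix n n ℂ,
    Continuous fun g => (toFun g : Matrix n n ℂ) * A * (toFun g : Matrix n n ℂ)ᴴ

section Cov

variable {n : Type*} [Fintype n] [DecidableEq n]

/-- The restriction of a projective representation to a subgroup. -/
def ProjRep.restrict {G : Type*} [Group G] [TopologicalSpace G] (V : ProjRep G n)
    (H : Subgroup G) : ProjRep H n where
  toFun h := V.toFun h
  map_mul g h := V.map_mul g h
  continuous_conj A := (V.continuous_conj A).comp continuous_subtype_val

variable {K : Type*} [Group K] [TopologicalSpace K] {Θ : Type*} [MulAction K Θ] [MeasurableSpace Θ]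

/-- `P` is covariant: `V_g† P(B) V_g = P(g⁻¹B)`. -/
def IsCovariant (V : ProjRep K n) (P : POVM Θ n) : Prop :=
  ∀ (g : K) (B : Set Θ), MeasurableSet B →
    (V.toFun g : Matrix n n ℂ)ᴴ * P.meas B * (V.toFun g : Matrix n n ℂ)
      = P.meas ((fun θ => g⁻¹ • θ) '' B)

/-- The invariant probability measure on the orbit `Kθ₀`: the distribution of `gθ₀` for a Haar
random `g`. It is regarded as a measure on `Θ`. -/
noncomputable def orbitMeasure (K : Type*) [Group K] [TopologicalSpace K] [IsTopologicalGroup K]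
    [CompactSpace K] [MeasurableSpace K] [BorelSpace K] {Θ : Type*} [MulAction K Θ]
    [MeasurableSpace Θ] (θ₀ : Θ) : Measure Θ :=
  (haarProb K).map fun g => g • θ₀

/-- `P₀ ≥ 0` is the seed, relative to the base point `θ₀`, of the measurement `P`: there is an
operator-valued function `p` with `p(gθ₀) = V_g P₀ V_g†` on the orbit of `θ₀` and
`P(B) = ∫_B p dν`, where `ν` is the invariant probability measure on the orbit.
(That `P₀` commutes with `V_g` for `g` in the stabilizer of `θ₀` and that
`∫ V_g P₀ V_g† dμ(g) = 1` follow from this.) -/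
def HasSeed [IsTopologicalGroup K] [CompactSpace K] [MeasurableSpace K] [BorelSpace K]
    (V : ProjRep K n) (θ₀ : Θ) (P : POVM Θ n) (P₀ : Matrix n n ℂ) : Prop :=
  P₀.PosSemidef ∧ ∃ p : Θ → Matrix n n ℂ,
    (∀ g : K, p (g • θ₀) = (V.toFun g : Matrix n n ℂ) * P₀ * (V.toFun g : Matrix n n ℂ)ᴴ) ∧
    ∀ B : Set Θ, MeasurableSet B → ∀ i j,
      P.meas B i j = ∫ θ in B, p θ i j ∂(orbitMeasure K θ₀)

end Cov

/-! ### The unitary group and unitary 2-designs -/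

section Unitary

variable {n : Type*} [Fintype n] [DecidableEq n]

instance : CompactSpace (unitaryGroup n ℂ) := by
  refine isCompact_iff_compactSpace (s := ((unitaryGroup n ℂ : Submonoid (Matrix n n ℂ)) :
    Set (Matrix n n ℂ))).mp ?_
  have h : IsCompact (Set.univ.pi fun _ : n => Set.univ.pi fun _ : n =>
      Metric.closedBall (0 : ℂ) 1) :=
    isCompact_univ_pi fun _ => isCompact_univ_pi fun _ => isCompact_closedBall _ _
  refine h.of_isClosed_subset (isClosed_unitary (R := Matrix n n ℂ)) ?_
  intro U hU i _ j _
  simpa using entry_norm_bound_of_unitary hU i j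

noncomputable instance : MeasurableSpace (unitaryGroup n ℂ) := borel _

instance : BorelSpace (unitaryGroup n ℂ) := ⟨rfl⟩

/-- A unitary 2-design: a finite set `S` of unitaries such that, for every state `ρ` of the doubled
system, `|S|⁻¹ ∑_{U ∈ S} U^{⊗2} ρ U^{†⊗2} = ∫ U^{⊗2} ρ U^{†⊗2} dU` (Haar measure on `U(n)`). -/
def IsUnitaryTwoDesign (S : Set (unitaryGroup n ℂ)) : Prop :=
  ∃ T : Finset (unitaryGroup n ℂ), (T : Set (unitaryGroup n ℂ)) = S ∧
    ∀ (ρ : DensityMatrix (n × n)) (a b : n × n),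
      (T.card : ℂ)⁻¹ * ∑ U ∈ T, (((U : Matrix n n ℂ) ⊗ₖ (U : Matrix n n ℂ)) * ρ.val
          * ((U : Matrix n n ℂ) ⊗ₖ (U : Matrix n n ℂ))ᴴ) a b
        = ∫ U : unitaryGroup n ℂ, (((U : Matrix n n ℂ) ⊗ₖ (U : Matrix n n ℂ)) * ρ.val
          * ((U : Matrix n n ℂ) ⊗ₖ (U : Matrix n n ℂ))ᴴ) a b ∂(haarProb (unitaryGroup n ℂ))

/-- The defining representation of the unitary group. -/
def stdRep (n : Type*) [Fintype n] [DecidableEq n] : ProjRep (unitaryGroup n ℂ) n where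
  toFun U := U
  map_mul g h := ⟨1, by simp, by simp⟩
  continuous_conj A := by fun_prop

end Unitary

/-! ### Pure states and the Pauli measurement -/

/-- Pure states on `ℂⁿ`, as rank-one orthogonal projections. -/
structure PureState (n : Type*) [Fintype n] where
  val : Matrix n n ℂ
  isHermitian : val.IsHermitian
  idem : val * val = val
  trace_eq_one : val.trace = 1

section Pure

variable {n : Type*} [Fintype n]

theorem PureState.posSemidef (θ : PureState n) : θ.val.PosSemidef := by
  have h := posSemidef_conjTranspose_mul_self θ.val
  rwa [θ.isHermitian.eq, θ.idem] at h

/-- A pure state as a density operator. -/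
def PureState.toDensity (θ : PureState n) : DensityMatrix n := ⟨θ.val, θ.posSemidef, θ.trace_eq_one⟩

noncomputable instance : TopologicalSpace (PureState n) := TopologicalSpace.induced PureState.val inferInstance

noncomputable instance : MeasurableSpace (PureState n) := borel _

instance : BorelSpace (PureState n) := ⟨rfl⟩

theorem PureState.ext' {θ η : PureState n} (h : θ.val = η.val) : θ = η := by
  cases θ; cases η; cases h; rfl

/-- The unitary group acts on pure states by `θ ↦ U θ U†`. -/
instance [DecidableEq n] : MulAction (unitaryGroup n ℂ) (PureState n) where
  smul U θ :=
    { val := (U : Matrix n n ℂ) * θ.val * (U : Matrix n n ℂ)ᴴ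
      isHermitian := isHermitian_mul_mul_conjTranspose _ θ.isHermitian
      idem := by
        have h : (U : Matrix n n ℂ)ᴴ * (U : Matrix n n ℂ) = 1 := mem_unitaryGroup_iff'.mp U.2
        calc (U : Matrix n n ℂ) * θ.val * (U : Matrix n n ℂ)ᴴ
              * ((U : Matrix n n ℂ) * θ.val * (U : Matrix n n ℂ)ᴴ)
            = (U : Matrix n n ℂ) * θ.val * ((U : Matrix n n ℂ)ᴴ * (U : Matrix n n ℂ)) * θ.val
              * (U : Matrix n n ℂ)ᴴ := by simp only [mul_assoc]
          _ = (U : Matrix n n ℂ) * (θ.val * θ.val) * (U : Matrix n n ℂ)ᴴ := by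
              rw [h]; simp only [mul_assoc, one_mul]
          _ = _ := by rw [θ.idem]
      trace_eq_one := by
        have h : (U : Matrix n n ℂ)ᴴ * (U : Matrix n n ℂ) = 1 := mem_unitaryGroup_iff'.mp U.2
        rw [trace_mul_comm, ← mul_assoc, h, one_mul, θ.trace_eq_one] }
  one_smul θ := by
    apply PureState.ext'
    change (1 : Matrix n n ℂ) * θ.val * (1 : Matrix n n ℂ)ᴴ = θ.val
    simp
  mul_smul U W θ := by
    apply PureState.ext'
    change ((U : Matrix n n ℂ) * (W : Matrix n n ℂ)) * θ.val
      * ((U : Matrix n n ℂ) * (W : Matrix n n ℂ))ᴴ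
      = (U : Matrix n n ℂ) * ((W : Matrix n n ℂ) * θ.val * (W : Matrix n n ℂ)ᴴ)
        * (U : Matrix n n ℂ)ᴴ
    simp only [conjTranspose_mul, mul_assoc]

end Pure

/-- The Pauli matrices `σ_x, σ_y, σ_z`. -/
noncomputable def pauli : Fin 3 → Matrix (Fin 2) (Fin 2) ℂ :=
  ![!![0, 1; 1, 0], !![0, -Complex.I; Complex.I, 0], !![1, 0; 0, -1]]

/-- The projection `(1 ± σ_k)/2` onto the eigenvector of the Pauli matrix `σ_k` with
eigenvalue `±1`. -/
noncomputable def pauliState (k : Fin 3) (s : ℤˣ) : PureState (Fin 2) where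
  val := (1 / 2 : ℂ) • (1 + ((s : ℤ) : ℂ) • pauli k)
  isHermitian := by
    rcases Int.units_eq_one_or s with rfl | rfl <;> fin_cases k <;>
      · ext i j
        fin_cases i <;> fin_cases j <;> simp [pauli] <;> ring
  idem := by
    have h1 : pauli k * pauli k = 1 := by
      fin_cases k <;>
        · ext i j
          fin_cases i <;> fin_cases j <;> simp [pauli, mul_apply]
    have h2 : ((s : ℤ) : ℂ) * ((s : ℤ) : ℂ) = 1 := by
      rcases Int.units_eq_one_or s with rfl | rfl <;> simp
    simp only [smul_mul_smul, add_mul, mul_add, one_mul, mul_one, h1, h2, one_smul]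
    module
  trace_eq_one := by
    rcases Int.units_eq_one_or s with rfl | rfl <;> fin_cases k <;>
      simp [pauli, trace_fin_two]

/-- The Pauli measurement of a qubit: one of `σ_x, σ_y, σ_z` is chosen with probability `1/3` each
and measured; the outcome is the resulting eigenstate. Thus each of the six eigenprojections `e`
is an outcome, with operator `e/3`. -/
noncomputable def pauliPOVM : POVM (PureState (Fin 2)) (Fin 2) where
  meas := ∑ k : Fin 3, ∑ s : ℤˣ,
    VectorMeasure.dirac (pauliState k s) ((1 / 3 : ℂ) • (pauliState k s).val)
  nonneg B hB := by
    classical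
    simp only [FunLike.coe_sum, Finset.sum_apply]
    refine Matrix.posSemidef_sum _ fun k _ => Matrix.posSemidef_sum _ fun s _ => ?_
    change (if _ then _ else _ : Matrix (Fin 2) (Fin 2) ℂ).PosSemidef
    split_ifs
    · exact (pauliState k s).posSemidef.smul (by positivity)
    · exact Matrix.PosSemidef.zero
  total := by
    simp only [FunLike.coe_sum, Finset.sum_apply,
      VectorMeasure.dirac_apply_of_mem MeasurableSet.univ (Set.mem_univ _)]
    have hu : ∀ F : ℤˣ → Matrix (Fin 2) (Fin 2) ℂ, ∑ s, F s = F 1 + F (-1) := fun F => by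
      rw [show (Finset.univ : Finset ℤˣ) = {1, -1} from rfl, Finset.sum_pair (by decide)]
    simp only [hu, Fin.sum_univ_three]
    ext i j
    fin_cases i <;> fin_cases j <;> simp [pauliState, pauli] <;> norm_num

end QEst

/-!
The minimax risk of a measurement with a seed depends on the group only through the second moments
of its Haar measure. This is why a 2-design does as well as the whole group.

Let `T` be a 2-design and let the unknown state be `U ρ₀ U†`, with `U` uniformly distributed on `T`.
For a Bregman divergence the best guess, given an outcome with effect `A`, is the posterior mean
`posteriorMean T ρ₀ A`, the average of `Tr(A U ρ₀ U†) U ρ₀ U†` over `T` when this has trace one. The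
expected loss of another guess is larger by its divergence from the posterior mean, which is
nonnegative by Klein's inequality (`bregmanReal_nonneg`, `bayesRisk_le`). The second moments in the
posterior mean agree with those of the unitary group, which are invariant under translations, so
that the posterior mean is equivariant in `A` and does not change if `ρ₀` is replaced by a conjugate
(`posteriorMean_unitaryConj`, `posteriorMean_conj`). Hence all outcomes of a measurement with seed
`P₀` have the same posterior risk, `bayesRisk f T ρ₀ P₀`, the difference of `Tr f` at `ρ₀` and at
the posterior mean for `P₀`.

* The Bayes risk is a lower bound for the minimax risk of a measurement with seed `P₀`
  (`HasSeed.bayesRisk_le_minimaxRisk`).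
* It is attained in all states of the orbit if the outcome `gθ₀` is answered by the posterior mean
  for `V_g P₀ V_g†`: the risk is an integral over the group of a function of second degree in
  `V_g ⊗ V_g†`, for which it suffices that the image of the group contains `T`
  (`lintegral_bregman_posteriorState`, `HasSeed.minimaxRisk_le`).

So measurements with the same seed, covariant under a group or under a subgroup which is a 2-design,
have the same minimax risk (`isMinimax_of_twoDesign`).

If moreover the seed is a multiple of a pure state `θ`, then every effect of every measurement is a
positive combination of conjugates of `θ`. The posterior bound for the conjugates adds up to an
operator inequality which holds for all effects, and integrating it against an arbitrary measurement
shows that no measurement beats the Bayes risk (`le_sum_lintegral_born`,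
`bayesRisk_le_minimaxRisk_of_pure`). For a qubit this applies to the covariant measurement with
density `2θ` and to the Pauli measurement, which is covariant under the binary octahedral group. This
group is a 2-design because the commutant of its tensor square is spanned by the identity and the
swap operator (`exists_eq_add_swap`, `isUnitaryTwoDesign_octahedralGroup`).
-/


namespace QEst

/-! ### Spectral calculus of Hermitian matrices -/

section Spectral

variable {n : Type*} [Fintype n] [DecidableEq n]

theorem cfc_eq_mul_diagonal_mul {A : Matrix n n ℂ} (hA : A.IsHermitian) (h : ℝ → ℝ) :
    cfc h A = (hA.eigenvectorUnitary : Matrix n n ℂ)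
      * diagonal (fun k => (h (hA.eigenvalues k) : ℂ))
      * (hA.eigenvectorUnitary : Matrix n n ℂ)ᴴ := by
  rw [hA.cfc_eq, IsHermitian.cfc, Unitary.conjStarAlgAut_apply]
  rfl

theorem cfc_entry {A : Matrix n n ℂ} (hA : A.IsHermitian) (h : ℝ → ℝ) (i j : n) :
    cfc h A i j = ∑ k, (hA.eigenvectorUnitary : Matrix n n ℂ) i k * (h (hA.eigenvalues k) : ℂ)
      * star ((hA.eigenvectorUnitary : Matrix n n ℂ) j k) := by
  rw [cfc_eq_mul_diagonal_mul hA, mul_apply]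
  simp [mul_diagonal]

/-- The functional calculus acts on an eigenvector by the value of the function at the
eigenvalue. -/
theorem cfc_mulVec_of_eigen {A : Matrix n n ℂ} (hA : A.IsHermitian) (h : ℝ → ℝ) {q : ℝ} {v : n → ℂ}
    (hv : A *ᵥ v = (q : ℂ) • v) : cfc h A *ᵥ v = (h q : ℂ) • v := by
  set U := (hA.eigenvectorUnitary : Matrix n n ℂ)
  have hU : Uᴴ * U = 1 := mem_unitaryGroup_iff'.mp hA.eigenvectorUnitary.2
  have hU' : U * Uᴴ = 1 := mem_unitaryGroup_iff.mp hA.eigenvectorUnitary.2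
  have hAd : A = U * diagonal (fun k => (hA.eigenvalues k : ℂ)) * Uᴴ := by
    have := cfc_eq_mul_diagonal_mul hA id
    rwa [cfc_id ℝ A hA.isSelfAdjoint] at this
  have hw : diagonal (fun k => (hA.eigenvalues k : ℂ)) *ᵥ (Uᴴ *ᵥ v) = (q : ℂ) • (Uᴴ *ᵥ v) := by
    rw [← mulVec_smul, ← hv]
    have : Uᴴ * A = diagonal (fun k => (hA.eigenvalues k : ℂ)) * Uᴴ := by
      conv_lhs => rw [hAd]
      simp only [← mul_assoc, hU, one_mul]
    rw [mulVec_mulVec, mulVec_mulVec, this]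
  have hw' : diagonal (fun k => (h (hA.eigenvalues k) : ℂ)) *ᵥ (Uᴴ *ᵥ v)
      = (h q : ℂ) • (Uᴴ *ᵥ v) := by
    ext k
    have hk := congrFun hw k
    simp only [mulVec_diagonal, Pi.smul_apply, smul_eq_mul] at hk ⊢
    rcases eq_or_ne ((Uᴴ *ᵥ v) k) 0 with h0 | h0
    · simp [h0]
    · rw [Complex.ofReal_injective (mul_right_cancel₀ h0 hk)]
  rw [cfc_eq_mul_diagonal_mul hA, ← mulVec_mulVec, ← mulVec_mulVec]
  change U *ᵥ (_ *ᵥ (Uᴴ *ᵥ v)) = _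
  rw [hw', mulVec_smul, mulVec_mulVec, hU', one_mulVec]

theorem cfc_conj_unitary (W : unitaryGroup n ℂ) {A : Matrix n n ℂ} (hA : A.IsHermitian)
    (h : ℝ → ℝ) :
    cfc h ((W : Matrix n n ℂ) * A * (W : Matrix n n ℂ)ᴴ)
      = (W : Matrix n n ℂ) * cfc h A * (W : Matrix n n ℂ)ᴴ := by
  have h1 : Unitary.conjStarAlgAut ℝ (Matrix n n ℂ) W (cfc h A)
      = cfc h (Unitary.conjStarAlgAut ℝ (Matrix n n ℂ) W A) :=
    StarAlgHomClass.map_cfc (S := ℝ) (R := ℝ) (Unitary.conjStarAlgAut ℝ (Matrix n n ℂ) W) h A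
      (A.finite_real_spectrum.continuousOn _) (by
        change Continuous fun A => (W : Matrix n n ℂ) * A * (star W : Matrix n n ℂ)
        fun_prop) hA.isSelfAdjoint (isHermitian_mul_mul_conjTranspose _ hA)
  exact h1.symm

/-- The trace of a product `g(S) h(R)`, in terms of the transition probabilities `|⟨u_j, v_k⟩|²`
between the eigenbases `u` of `S` and `v` of `R`. -/
theorem trace_cfc_mul_cfc {S R : Matrix n n ℂ} (hS : S.IsHermitian) (hR : R.IsHermitian)
    (g h : ℝ → ℝ) :
    (cfc g S * cfc h R).trace = ((∑ j, ∑ k,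
      ‖((hS.eigenvectorUnitary : Matrix n n ℂ)ᴴ * (hR.eigenvectorUnitary : Matrix n n ℂ)) j k‖ ^ 2
        * (g (hS.eigenvalues j) * h (hR.eigenvalues k)) : ℝ) : ℂ) := by
  rw [cfc_eq_mul_diagonal_mul hS, cfc_eq_mul_diagonal_mul hR]
  set U := (hS.eigenvectorUnitary : Matrix n n ℂ)
  set V := (hR.eigenvectorUnitary : Matrix n n ℂ)
  have : (U * diagonal (fun k => (g (hS.eigenvalues k) : ℂ)) * Uᴴ
      * (V * diagonal (fun k => (h (hR.eigenvalues k) : ℂ)) * Vᴴ)).trace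
      = (diagonal (fun k => (g (hS.eigenvalues k) : ℂ)) * (Uᴴ * V)
        * (diagonal (fun k => (h (hR.eigenvalues k) : ℂ)) * (Uᴴ * V)ᴴ)).trace := by
    rw [mul_assoc, mul_assoc, trace_mul_comm]
    simp only [conjTranspose_mul, conjTranspose_conjTranspose, mul_assoc]
  rw [this, trace]
  push_cast
  refine Finset.sum_congr rfl fun j _ => ?_
  rw [diag_apply, mul_apply]
  refine Finset.sum_congr rfl fun k _ => ?_
  rw [diagonal_mul, diagonal_mul, conjTranspose_apply, ← Complex.mul_conj']
  simp only [RCLike.star_def]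
  ring

end Spectral

/-! ### The Bregman divergence -/

theorem DensityMatrix.ext' {n : Type*} [Fintype n] {ρ σ : DensityMatrix n} (h : ρ.val = σ.val) :
    ρ = σ := by
  cases ρ; cases σ; cases h; rfl

theorem DensityMatrix.isHermitian {n : Type*} [Fintype n] (σ : DensityMatrix n) :
    σ.val.IsHermitian := σ.posSemidef.1

section Bregman

variable {n : Type*} [Fintype n] [DecidableEq n]

theorem DensityMatrix.eigenvalues_mem_Icc (σ : DensityMatrix n) (k : n) :
    σ.isHermitian.eigenvalues k ∈ Set.Icc (0 : ℝ) 1 := by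
  have h0 := fun j => σ.posSemidef.eigenvalues_nonneg j
  refine ⟨h0 k, ?_⟩
  have h1 : ∑ j, σ.isHermitian.eigenvalues j = 1 := by
    have := σ.isHermitian.trace_eq_sum_eigenvalues
    rw [σ.trace_eq_one] at this
    exact Complex.ofReal_injective (by simpa using this.symm)
  rw [← h1]
  exact Finset.single_le_sum (fun j _ => h0 j) (Finset.mem_univ k)

/-- The real number `Tr f(A)`. -/
noncomputable def traceFun (f : ℝ → ℝ) (A : Matrix n n ℂ) : ℝ := (cfc f A).trace.re

theorem traceFun_conj_unitary (f : ℝ → ℝ) (W : unitaryGroup n ℂ) {A : Matrix n n ℂ}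
    (hA : A.IsHermitian) :
    traceFun f ((W : Matrix n n ℂ) * A * (W : Matrix n n ℂ)ᴴ) = traceFun f A := by
  have hW : (W : Matrix n n ℂ)ᴴ * (W : Matrix n n ℂ) = 1 := mem_unitaryGroup_iff'.mp W.2
  rw [traceFun, cfc_conj_unitary W hA, trace_mul_comm, ← mul_assoc, hW, one_mul, traceFun]

/-- The condition for the Bregman divergence to be finite: `σ` and `ρ` agree on the eigenspaces of
`σ` for those eigenvalues at which `f` has no finite derivative. -/
def BregmanFinite (f : ℝ → ℝ) (R S : Matrix n n ℂ) : Prop :=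
  ∀ q : ℝ, ¬ DifferentiableWithinAt ℝ f (Set.Icc 0 1) q →
      ∀ v : n → ℂ, S *ᵥ v = (q : ℂ) • v → R *ᵥ v = (q : ℂ) • v

/-- The real number `Tr f(R) - Tr f(S) - Tr f'(S)(R - S)`. -/
noncomputable def bregmanReal (f : ℝ → ℝ) (R S : Matrix n n ℂ) : ℝ :=
  traceFun f R - traceFun f S
    - (cfc (derivWithin f (Set.Icc 0 1)) S * (R - S)).trace.re

theorem bregman_of_finite {f : ℝ → ℝ} {ρ σ : DensityMatrix n}
    (h : BregmanFinite f ρ.val σ.val) :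
    bregman f ρ σ = ENNReal.ofReal (bregmanReal f ρ.val σ.val) := by
  refine (if_pos h).trans ?_
  rw [bregmanReal, traceFun, traceFun, trace_sub, trace_sub, Complex.sub_re, Complex.sub_re]

theorem bregman_of_not_finite {f : ℝ → ℝ} {ρ σ : DensityMatrix n}
    (h : ¬ BregmanFinite f ρ.val σ.val) : bregman f ρ σ = ⊤ :=
  if_neg h

/-- A convex function lies above its tangents. -/
theorem tangent_le {f : ℝ → ℝ} (hf : ConvexOn ℝ (Set.Icc 0 1) f) {r s : ℝ}
    (hr : r ∈ Set.Icc (0 : ℝ) 1) (hs : s ∈ Set.Icc (0 : ℝ) 1)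
    (hd : DifferentiableWithinAt ℝ f (Set.Icc 0 1) s) :
    0 ≤ f r - f s - derivWithin f (Set.Icc 0 1) s * (r - s) := by
  rcases lt_trichotomy s r with h | h | h
  · have := hf.derivWithin_le_slope hs hr h hd
    rw [slope_def_field, le_div_iff₀ (sub_pos.mpr h)] at this
    linarith
  · simp [h]
  · have := hf.slope_le_derivWithin hr hs h hd
    rw [slope_def_field, div_le_iff₀ (sub_pos.mpr h)] at this
    linarith

/-- **Klein's inequality**: the Bregman divergence, where finite, is nonnegative. In eigenbases of
`S` and `R` it is an average of the corresponding scalar divergences, weighted with the transition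
probabilities. -/
theorem bregmanReal_nonneg {f : ℝ → ℝ} (hf : IsBregmanGenerator f) {ρ σ : DensityMatrix n}
    (h : BregmanFinite f ρ.val σ.val) : 0 ≤ bregmanReal f ρ.val σ.val := by
  set f' := derivWithin f (Set.Icc 0 1)
  have hS := σ.isHermitian
  have hR := ρ.isHermitian
  set S := σ.val
  set R := ρ.val
  have e1 : (cfc f R).trace = (cfc (fun _ => (1 : ℝ)) S * cfc f R).trace := by
    rw [cfc_const_one ℝ S hS.isSelfAdjoint, one_mul]
  have e2 : (cfc f S).trace = (cfc f S * cfc (fun _ => (1 : ℝ)) R).trace := by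
    rw [cfc_const_one ℝ R hR.isSelfAdjoint, mul_one]
  have e3 : (cfc f' S * R).trace = (cfc f' S * cfc (fun x : ℝ => x) R).trace := by
    rw [cfc_id' ℝ R hR.isSelfAdjoint]
  have e4 : (cfc f' S * S).trace
      = (cfc (fun x => f' x * x) S * cfc (fun _ => (1 : ℝ)) R).trace := by
    rw [cfc_const_one ℝ R hR.isSelfAdjoint, mul_one, cfc_mul f' (fun x => x) S
      (S.finite_real_spectrum.continuousOn _) (S.finite_real_spectrum.continuousOn _),
      cfc_id' ℝ S hS.isSelfAdjoint]
  rw [bregmanReal, traceFun, traceFun, mul_sub, trace_sub, Complex.sub_re, e1, e2, e3, e4]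
  simp only [trace_cfc_mul_cfc hS hR, Complex.ofReal_re, ← Finset.sum_sub_distrib]
  refine Finset.sum_nonneg fun j _ => Finset.sum_nonneg fun k _ => ?_
  set c := ((hS.eigenvectorUnitary : Matrix n n ℂ)ᴴ * (hR.eigenvectorUnitary : Matrix n n ℂ)) j k
    with hc
  set s := hS.eigenvalues j with hs
  set r := hR.eigenvalues k with hr
  have key : 0 ≤ ‖c‖ ^ 2 * (f r - f s - f' s * (r - s)) := by
    by_cases hd : DifferentiableWithinAt ℝ f (Set.Icc 0 1) s
    · exact mul_nonneg (sq_nonneg _) (tangent_le hf.strictConvexOn.convexOn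
        (ρ.eigenvalues_mem_Icc k) (σ.eigenvalues_mem_Icc j) hd)
    -- At a singular eigenvalue of `σ` only equal eigenvalues of `ρ` have a nonzero weight.
    have h1 : R *ᵥ (hS.eigenvectorBasis j : n → ℂ) = (s : ℂ) • (hS.eigenvectorBasis j : n → ℂ) :=
      h s hd _ (by simpa [← Complex.coe_smul] using hS.mulVec_eigenvectorBasis j)
    have h2 : R *ᵥ (hR.eigenvectorBasis k : n → ℂ) = (r : ℂ) • (hR.eigenvectorBasis k : n → ℂ) := by
      simpa [← Complex.coe_smul] using hR.mulVec_eigenvectorBasis k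
    have h3 : c = star (hS.eigenvectorBasis j : n → ℂ) ⬝ᵥ (hR.eigenvectorBasis k : n → ℂ) := by
      rw [hc, mul_apply]; rfl
    have h4 : (r : ℂ) * c = s * c := by
      have : star (R *ᵥ (hS.eigenvectorBasis j : n → ℂ)) ⬝ᵥ (hR.eigenvectorBasis k : n → ℂ)
          = star (hS.eigenvectorBasis j : n → ℂ) ⬝ᵥ R *ᵥ (hR.eigenvectorBasis k : n → ℂ) := by
        rw [star_mulVec, hR.eq, dotProduct_mulVec]
      rw [h1, h2] at this
      simpa [h3, star_smul] using this.symm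
    rcases eq_or_ne c 0 with h0 | h0
    · simp [h0]
    · rw [Complex.ofReal_injective (mul_right_cancel₀ h0 h4)]
      simp
  linarith

end Bregman

/-! ### Measurability of the loss -/

theorem measurable_mul_entry {n X : Type*} [Fintype n] [MeasurableSpace X]
    {A B : X → Matrix n n ℂ} (hA : ∀ i j, Measurable fun x => A x i j)
    (hB : ∀ i j, Measurable fun x => B x i j) (i j : n) :
    Measurable fun x => (A x * B x) i j := by
  simp only [mul_apply]
  exact Finset.measurable_sum _ fun k _ => (hA i k).mul (hB k j)

theorem measurable_trace {n X : Type*} [Fintype n] [MeasurableSpace X]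
    {A : X → Matrix n n ℂ} (hA : ∀ i j, Measurable fun x => A x i j) :
    Measurable fun x => (A x).trace :=
  Finset.measurable_sum _ fun k _ => hA k k

section Measurability

variable {n : Type*} [Fintype n] [DecidableEq n] {X : Type*} [MeasurableSpace X]

theorem DensityMatrix.cfc_congr (σ : DensityMatrix n) {g h : ℝ → ℝ}
    (H : Set.EqOn g h (Set.Icc 0 1)) : cfc g σ.val = cfc h σ.val := by
  ext i j
  rw [cfc_entry σ.isHermitian, cfc_entry σ.isHermitian]
  exact Finset.sum_congr rfl fun k _ => by rw [H (σ.eigenvalues_mem_Icc k)]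

/-- The functional calculus with `h` of the estimated state is a measurable function of the outcome.
Measurability of matrix-valued functions is understood entrywise. -/
def CfcMeasurable (e : Estimator X n) (h : ℝ → ℝ) : Prop :=
  ∀ i j, Measurable fun x => cfc h (e.toFun x).val i j

namespace CfcMeasurable

variable {e : Estimator X n}

theorem congr {g h : ℝ → ℝ} (hg : CfcMeasurable e g)
    (H : Set.EqOn g h (Set.Icc 0 1)) : CfcMeasurable e h := fun i j => by
  simpa only [(e.toFun _).cfc_congr H] using hg i j

theorem mul {g h : ℝ → ℝ} (hg : CfcMeasurable e g) (hh : CfcMeasurable e h) :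
    CfcMeasurable e fun x => g x * h x := fun i j => by
  have : ∀ x, cfc (fun t => g t * h t) (e.toFun x).val
      = cfc g (e.toFun x).val * cfc h (e.toFun x).val := fun x =>
    cfc_mul g h _ ((e.toFun x).val.finite_real_spectrum.continuousOn _)
      ((e.toFun x).val.finite_real_spectrum.continuousOn _)
  simp only [this]
  exact measurable_mul_entry hg hh i j

theorem add {g h : ℝ → ℝ} (hg : CfcMeasurable e g) (hh : CfcMeasurable e h) :
    CfcMeasurable e fun x => g x + h x := fun i j => by
  have : ∀ x, cfc (fun t => g t + h t) (e.toFun x).val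
      = cfc g (e.toFun x).val + cfc h (e.toFun x).val := fun x =>
    cfc_add _ g h ((e.toFun x).val.finite_real_spectrum.continuousOn _)
      ((e.toFun x).val.finite_real_spectrum.continuousOn _)
  simp only [this]
  exact (hg i j).add (hh i j)

theorem of_const (c : ℝ) : CfcMeasurable e fun _ => c := fun i j => by
  simp only [cfc_const c _ (e.toFun _).isHermitian.isSelfAdjoint]
  exact measurable_const

theorem of_id : CfcMeasurable e fun t => t := fun i j => by
  simpa only [cfc_id' ℝ _ (e.toFun _).isHermitian.isSelfAdjoint] using e.measurable_entry i j

theorem of_pow (k : ℕ) : CfcMeasurable e fun t => t ^ k := by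
  induction k with
  | zero => simpa using of_const (e := e) 1
  | succ k ih => simpa only [pow_succ] using ih.mul of_id

theorem of_polynomial (p : Polynomial ℝ) : CfcMeasurable e fun t => p.eval t := by
  induction p using Polynomial.induction_on' with
  | add p q hp hq => simpa only [Polynomial.eval_add] using hp.add hq
  | monomial k a => simpa only [Polynomial.eval_monomial] using (of_const a).mul (of_pow k)

/-- The spectra being finite, pointwise convergence of functions carries over to the functional
calculus. -/
theorem of_tendsto {g : ℕ → ℝ → ℝ} {h : ℝ → ℝ} (hg : ∀ k, CfcMeasurable e (g k))
    (H : ∀ t ∈ Set.Icc (0 : ℝ) 1, Filter.Tendsto (fun k => g k t) Filter.atTop (nhds (h t))) :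
    CfcMeasurable e h := fun i j => by
  refine measurable_of_tendsto_metrizable (fun k => hg k i j) (tendsto_pi_nhds.mpr fun x => ?_)
  simp only [cfc_entry (e.toFun x).isHermitian]
  refine tendsto_finsetSum _ fun k _ => Filter.Tendsto.mul_const _ (Filter.Tendsto.const_mul _ ?_)
  exact (Complex.continuous_ofReal.tendsto _).comp (H _ ((e.toFun x).eigenvalues_mem_Icc k))

theorem of_continuousOn {h : ℝ → ℝ} (hh : ContinuousOn h (Set.Icc 0 1)) : CfcMeasurable e h := by
  choose p hp using fun k : ℕ => exists_polynomial_near_of_continuousOn 0 1 h hh (1 / ((k : ℝ) + 1))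
    Nat.one_div_pos_of_nat
  refine of_tendsto (fun k => of_polynomial (p k)) fun t ht => ?_
  rw [tendsto_iff_dist_tendsto_zero]
  exact squeeze_zero (fun _ => dist_nonneg) (fun k => (hp k t ht).le)
    tendsto_one_div_add_atTop_nhds_zero_nat

theorem of_indicator_one : CfcMeasurable e (Set.indicator {1} 1) := by
  refine of_tendsto of_pow fun t ht => ?_
  rcases ht.2.eq_or_lt with rfl | h
  · simp
  · simpa [Set.indicator, h.ne] using tendsto_pow_atTop_nhds_zero_of_lt_one ht.1 h

theorem of_indicator_zero : CfcMeasurable e (Set.indicator {0} 1) := by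
  refine of_tendsto (g := fun k t => (1 - t) ^ k)
    (fun k => of_continuousOn (by fun_prop)) fun t ht => ?_
  rcases ht.1.eq_or_lt with rfl | h
  · simp
  · simpa [Set.indicator, h.ne'] using
      tendsto_pow_atTop_nhds_zero_of_lt_one (sub_nonneg.mpr ht.2) (by linarith)

/-- In the interior, `f'` is a limit of difference quotients of a continuous extension of `f`;
the end points are treated separately, as the derivative may have no limit there. -/
theorem of_derivWithin {f : ℝ → ℝ} (hf : IsBregmanGenerator f) :
    CfcMeasurable e (derivWithin f (Set.Icc 0 1)) := by
  set F : ℝ → ℝ := Set.IccExtend zero_le_one (Set.domRestrict (Set.Icc 0 1) f) with hF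
  have hFc : Continuous F :=
    (continuousOn_iff_continuous_domRestrict.mp hf.continuousOn).Icc_extend'
  have hFf : ∀ t ∈ Set.Icc (0 : ℝ) 1, F t = f t := fun t ht => Set.IccExtend_of_mem _ _ ht
  set f' := derivWithin f (Set.Icc 0 1) with hf'
  set χ : ℝ → ℝ := fun t => 1 + (-1) * Set.indicator {0} 1 t + (-1) * Set.indicator {1} 1 t
  have hχ : CfcMeasurable e χ :=
    ((of_const 1).add ((of_const (-1)).mul of_indicator_zero)).add
      ((of_const (-1)).mul of_indicator_one)
  have h1 : CfcMeasurable e fun t => χ t * f' t := by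
    refine of_tendsto (g := fun k t => χ t * (((k : ℝ) + 1) * (F (t + 1 / ((k : ℝ) + 1)) - F t)))
      (fun k => hχ.mul (of_continuousOn (by fun_prop))) fun t ht => ?_
    rcases ht.1.eq_or_lt with rfl | h0
    · simp [χ]
    rcases ht.2.eq_or_lt with rfl | h1
    · simp [χ]
    refine Filter.Tendsto.const_mul _ ?_
    have hn : Set.Icc (0 : ℝ) 1 ∈ nhds t := Icc_mem_nhds h0 h1
    have hd : HasDerivAt f (f' t) t := by
      have : DifferentiableAt ℝ f t :=
        ((hf.contDiffOn t ⟨h0, h1⟩).contDiffAt (Ioo_mem_nhds h0 h1)).differentiableAt (by simp)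
      rw [hf', derivWithin_of_mem_nhds hn]
      exact this.hasDerivAt
    have hdF : HasDerivAt F (f' t) t :=
      hd.congr_of_eventuallyEq (Filter.eventually_of_mem hn hFf)
    have hs := (hasDerivAt_iff_tendsto_slope_zero.mp hdF).comp
      (tendsto_nhdsWithin_iff.mpr ⟨tendsto_one_div_add_atTop_nhds_zero_nat (𝕜 := ℝ),
        Filter.Eventually.of_forall fun k : ℕ => (Nat.one_div_pos_of_nat (α := ℝ)).ne'⟩)
    refine hs.congr fun k => ?_
    simp
  refine ((h1.add ((of_const (f' 0)).mul of_indicator_zero)).add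
    ((of_const (f' 1)).mul of_indicator_one)).congr fun t ht => ?_
  by_cases h0 : t = 0
  · simp [h0, χ]
  by_cases h1 : t = 1
  · simp [h1, χ]
  simp [h0, h1, χ, Set.indicator]

end CfcMeasurable

/-- The eigenprojection of `S` for `q` is the functional calculus of `S` with an indicator
function. -/
theorem forall_eigenvector_iff {S : Matrix n n ℂ} (hS : S.IsHermitian) (R : Matrix n n ℂ) (q : ℝ) :
    (∀ v : n → ℂ, S *ᵥ v = (q : ℂ) • v → R *ᵥ v = (q : ℂ) • v) ↔
      (R - (q : ℂ) • (1 : Matrix n n ℂ)) * cfc (Set.indicator {q} 1) S = 0 := by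
  constructor
  · intro h
    have hP : S * cfc (Set.indicator {q} 1) S
        = (q : ℂ) • cfc (Set.indicator {q} (1 : ℝ → ℝ)) S := by
      have h1 : (fun t : ℝ => t * Set.indicator {q} (1 : ℝ → ℝ) t)
          = fun t => q * Set.indicator {q} (1 : ℝ → ℝ) t := by
        ext t
        by_cases ht : t = q <;> simp [ht]
      have h2 := cfc_mul (fun t => t) (Set.indicator {q} (1 : ℝ → ℝ)) S
        (S.finite_real_spectrum.continuousOn _) (S.finite_real_spectrum.continuousOn _)
      rw [h1, cfc_id' ℝ S hS.isSelfAdjoint, cfc_const_mul _ _ _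
        (S.finite_real_spectrum.continuousOn _)] at h2
      rw [← h2, Complex.coe_smul]
    refine Matrix.ext_of_mulVec_single fun j => ?_
    rw [← mulVec_mulVec, sub_mulVec, h _ (by rw [mulVec_mulVec, hP, smul_mulVec])]
    simp only [smul_mulVec, one_mulVec, sub_self, zero_mulVec]
  · intro h v hv
    have h1 := cfc_mulVec_of_eigen hS (Set.indicator {q} 1) hv
    have h2 := congrArg (· *ᵥ v) h
    simp only [← mulVec_mulVec, h1] at h2
    simpa [sub_mulVec, smul_mulVec, sub_eq_zero] using h2

theorem IsBregmanGenerator.differentiableWithinAt {f : ℝ → ℝ} (hf : IsBregmanGenerator f) {q : ℝ}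
    (h0 : q ≠ 0) (h1 : q ≠ 1) : DifferentiableWithinAt ℝ f (Set.Icc 0 1) q := by
  by_cases hq : q ∈ Set.Icc (0 : ℝ) 1
  · have hq' : q ∈ Set.Ioo (0 : ℝ) 1 := ⟨hq.1.lt_of_ne' h0, hq.2.lt_of_ne h1⟩
    exact (((hf.contDiffOn q hq').contDiffAt (isOpen_Ioo.mem_nhds hq')).differentiableAt
      (by simp)).differentiableWithinAt
  · exact (HasFDerivWithinAt.of_notMem_closure (f' := 0)
      (by rwa [isClosed_Icc.closure_eq])).differentiableWithinAt

theorem measurable_bregman {f : ℝ → ℝ} (hf : IsBregmanGenerator f) (ρ : DensityMatrix n)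
    (e : Estimator X n) : Measurable fun x => bregman f ρ (e.toFun x) := by
  classical
  have hset : MeasurableSet {x | BregmanFinite f ρ.val (e.toFun x).val} := by
    have h1 : ∀ q : ℝ, CfcMeasurable e (Set.indicator {q} 1) → MeasurableSet
        {x | ∀ v : n → ℂ, (e.toFun x).val *ᵥ v = (q : ℂ) • v → ρ.val *ᵥ v = (q : ℂ) • v} := by
      intro q hq
      simp only [forall_eigenvector_iff (e.toFun _).isHermitian, ← Matrix.ext_iff]
      have hm := measurable_mul_entry
        (A := fun _ : X => ρ.val - (q : ℂ) • (1 : Matrix n n ℂ)) (fun i j => measurable_const) hq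
      simp only [Set.ofPred_forall]
      exact MeasurableSet.iInter fun i => MeasurableSet.iInter fun j =>
        hm i j (measurableSet_singleton 0)
    have h2 : {x | BregmanFinite f ρ.val (e.toFun x).val} = ⋂ q ∈ ({0, 1} : Finset ℝ),
        {x | ¬ DifferentiableWithinAt ℝ f (Set.Icc 0 1) q →
          ∀ v : n → ℂ, (e.toFun x).val *ᵥ v = (q : ℂ) • v → ρ.val *ᵥ v = (q : ℂ) • v} := by
      ext x
      simp only [Set.mem_iInter, Set.mem_ofPred_eq]
      refine ⟨fun h q _ => h q, fun h q hq => h q ?_ hq⟩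
      by_contra h01
      simp only [Finset.mem_insert, Finset.mem_singleton, not_or] at h01
      exact hq (hf.differentiableWithinAt h01.1 h01.2)
    rw [h2]
    refine Finset.measurableSet_biInter _ fun q hq => ?_
    by_cases hd : DifferentiableWithinAt ℝ f (Set.Icc 0 1) q
    · simp [hd]
    · simp only [hd, not_false_eq_true, forall_true_left]
      refine h1 q ?_
      simp only [Finset.mem_insert, Finset.mem_singleton] at hq
      rcases hq with rfl | rfl
      exacts [CfcMeasurable.of_indicator_zero, CfcMeasurable.of_indicator_one]
  have hreal : Measurable fun x => bregmanReal f ρ.val (e.toFun x).val := by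
    refine Measurable.sub (measurable_const.sub ?_) ?_
    · exact Complex.measurable_re.comp
        (measurable_trace (CfcMeasurable.of_continuousOn hf.continuousOn))
    · exact Complex.measurable_re.comp (measurable_trace
        (measurable_mul_entry (CfcMeasurable.of_derivWithin hf)
          fun i j => measurable_const.sub (e.measurable_entry i j)))
  have : (fun x => bregman f ρ (e.toFun x)) = fun x =>
      if BregmanFinite f ρ.val (e.toFun x).val
      then ENNReal.ofReal (bregmanReal f ρ.val (e.toFun x).val) else ⊤ := by
    ext x
    split_ifs with h
    exacts [bregman_of_finite h, bregman_of_not_finite h]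
  rw [this]
  exact Measurable.ite hset (ENNReal.measurable_ofReal.comp hreal) measurable_const

end Measurability

/-! ### Haar measure of a compact group -/

section Haar

variable (K : Type*) [Group K] [TopologicalSpace K] [IsTopologicalGroup K] [CompactSpace K]
  [MeasurableSpace K] [BorelSpace K]

instance : (haarProb K).IsHaarMeasure := inferInstanceAs (Measure.haarMeasure _).IsHaarMeasure

instance : IsProbabilityMeasure (haarProb K) :=
  ⟨by simpa [haarProb] using
    Measure.haarMeasure_self (K₀ := (⊤ : TopologicalSpace.PositiveCompacts K))⟩

/-- Compact groups are unimodular. -/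
instance : (haarProb K).IsMulRightInvariant where
  map_mul_right_eq_self g := by
    have h := Measure.isMulInvariant_eq_smul_of_compactSpace
      ((haarProb K).map (· * g)) (haarProb K)
    have h1 := congrArg (fun μ => μ Set.univ) h
    simp only [Measure.map_apply (measurable_mul_const g) MeasurableSet.univ, Set.preimage_univ,
      measure_univ, Measure.smul_apply, smul_eq_mul, ENNReal.smul_def, mul_one] at h1
    rw [h, ENNReal.smul_def, ← h1, one_smul]

instance : (haarProb K).IsInvInvariant where
  inv_eq_self := by
    have h := Measure.isMulInvariant_eq_smul_of_compactSpace (haarProb K).inv (haarProb K)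
    have h1 := congrArg (fun μ => μ Set.univ) h
    simp only [Measure.inv_apply, Set.inv_univ,
      measure_univ, Measure.smul_apply, smul_eq_mul, ENNReal.smul_def, mul_one] at h1
    rw [h, ENNReal.smul_def, ← h1, one_smul]

variable {K} in
theorem integrable_haarProb {E : Type*} [NormedAddCommGroup E] [SecondCountableTopology E]
    {F : K → E} (hF : Continuous F) : Integrable F (haarProb K) := by
  borelize E
  obtain ⟨C, hC⟩ := (isCompact_range hF).isBounded.exists_norm_le
  exact Integrable.of_bound hF.aestronglyMeasurable C
    (Filter.Eventually.of_forall fun x => hC _ ⟨x, rfl⟩)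

end Haar

/-! ### The second-order twirl -/

theorem trace_mul_eq_sum_sum {n : Type*} [Fintype n] (C M : Matrix n n ℂ) :
    (C * M).trace = ∑ a, ∑ b, C a b * M b a := by
  simp only [trace, diag_apply, mul_apply]

section Twirl

variable {n : Type*} [Fintype n] [DecidableEq n]

/-- The conjugate `U A U†`. -/
def unitaryConj (U : unitaryGroup n ℂ) (A : Matrix n n ℂ) : Matrix n n ℂ :=
  (U : Matrix n n ℂ) * A * (U : Matrix n n ℂ)ᴴ

theorem unitaryConj_mul (U W : unitaryGroup n ℂ) (A : Matrix n n ℂ) :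
    unitaryConj (U * W) A = unitaryConj U (unitaryConj W A) := by
  simp only [unitaryConj, Submonoid.coe_mul, conjTranspose_mul, mul_assoc]

theorem unitaryConj_one (A : Matrix n n ℂ) : unitaryConj 1 A = A := by
  simp [unitaryConj]

theorem trace_unitaryConj (U : unitaryGroup n ℂ) (A : Matrix n n ℂ) :
    (unitaryConj U A).trace = A.trace := by
  have hU : (U : Matrix n n ℂ)ᴴ * (U : Matrix n n ℂ) = 1 := mem_unitaryGroup_iff'.mp U.2
  rw [unitaryConj, trace_mul_comm, ← mul_assoc, hU, one_mul]

theorem trace_mul_unitaryConj (U : unitaryGroup n ℂ) (A B : Matrix n n ℂ) :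
    (A * unitaryConj U B).trace = (unitaryConj U⁻¹ A * B).trace := by
  simp only [unitaryConj, UnitaryGroup.inv_val, star_eq_conjTranspose, conjTranspose_conjTranspose]
  rw [← mul_assoc, trace_mul_comm]
  simp only [mul_assoc]

theorem trace_unitaryConj_mul (U : unitaryGroup n ℂ) (A B : Matrix n n ℂ) :
    (unitaryConj U A * B).trace = (A * unitaryConj U⁻¹ B).trace := by
  rw [trace_mul_unitaryConj, inv_inv]

theorem posSemidef_unitaryConj (U : unitaryGroup n ℂ) {A : Matrix n n ℂ} (hA : A.PosSemidef) :
    (unitaryConj U A).PosSemidef := hA.mul_mul_conjTranspose_same _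

theorem continuous_unitaryConj (A : Matrix n n ℂ) :
    Continuous fun U : unitaryGroup n ℂ => unitaryConj U A := by
  unfold unitaryConj
  fun_prop

/-- The second moment `∫ Tr(A U X U†) Tr(B U Y U†) dU` of the Haar measure of the unitary group. -/
noncomputable def haarMoment (A B X Y : Matrix n n ℂ) : ℂ :=
  ∫ U, (A * unitaryConj U X).trace * (B * unitaryConj U Y).trace ∂(haarProb (unitaryGroup n ℂ))

theorem haarMoment_conj_right (W : unitaryGroup n ℂ) (A B X Y : Matrix n n ℂ) :
    haarMoment A B (unitaryConj W X) (unitaryConj W Y) = haarMoment A B X Y := by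
  simp only [haarMoment, ← unitaryConj_mul]
  exact integral_mul_right_eq_self
    (fun U => (A * unitaryConj U X).trace * (B * unitaryConj U Y).trace) W

theorem haarMoment_symm (A B X Y : Matrix n n ℂ) : haarMoment A B X Y = haarMoment X Y A B := by
  rw [haarMoment, ← integral_inv_eq_self, haarMoment]
  refine integral_congr_ae (Filter.Eventually.of_forall fun U => ?_)
  simp only [trace_mul_unitaryConj, inv_inv]
  rw [trace_mul_comm, trace_mul_comm (unitaryConj U B), trace_mul_unitaryConj,
    trace_mul_unitaryConj]

theorem haarMoment_conj_left (W : unitaryGroup n ℂ) (A B X Y : Matrix n n ℂ) :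
    haarMoment (unitaryConj W A) (unitaryConj W B) X Y = haarMoment A B X Y := by
  rw [haarMoment_symm, haarMoment_conj_right, haarMoment_symm]

/-- The average over `T` reproduces the second moments of the Haar measure. -/
def MatchesHaarMoments (T : Finset (unitaryGroup n ℂ)) : Prop :=
  ∀ A B X Y : Matrix n n ℂ, (T.card : ℂ)⁻¹ * ∑ U ∈ T,
    (A * unitaryConj U X).trace * (B * unitaryConj U Y).trace = haarMoment A B X Y

open scoped MatrixOrder Matrix.Norms.L2Operator in
theorem span_posSemidef : Submodule.span ℂ {A : Matrix n n ℂ | A.PosSemidef} = ⊤ := by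
  rw [← CStarAlgebra.span_nonneg (A := Matrix n n ℂ)]
  simp only [nonneg_iff_posSemidef]

theorem trace_kronecker_conj (U : unitaryGroup n ℂ) (A B X Y : Matrix n n ℂ) :
    ((A ⊗ₖ B) * (((U : Matrix n n ℂ) ⊗ₖ (U : Matrix n n ℂ)) * (X ⊗ₖ Y)
      * ((U : Matrix n n ℂ) ⊗ₖ (U : Matrix n n ℂ))ᴴ)).trace
      = (A * unitaryConj U X).trace * (B * unitaryConj U Y).trace := by
  rw [conjTranspose_kronecker, ← mul_kronecker_mul, ← mul_kronecker_mul, ← mul_kronecker_mul,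
    trace_kronecker]
  rfl

theorem continuous_kronecker_conj (X : Matrix (n × n) (n × n) ℂ) :
    Continuous fun U : unitaryGroup n ℂ => ((U : Matrix n n ℂ) ⊗ₖ (U : Matrix n n ℂ)) * X
      * ((U : Matrix n n ℂ) ⊗ₖ (U : Matrix n n ℂ))ᴴ := by
  have : Continuous fun U : unitaryGroup n ℂ => (U : Matrix n n ℂ) ⊗ₖ (U : Matrix n n ℂ) := by
    refine continuous_matrix fun a b => ?_
    exact (continuous_subtype_val.matrix_elem _ _).mul (continuous_subtype_val.matrix_elem _ _)
  fun_prop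

/-- The defining property of a 2-design extends from states to all operators, by linearity. -/
theorem IsUnitaryTwoDesign.exists_matchesHaarMoments {S : Set (unitaryGroup n ℂ)}
    (hS : IsUnitaryTwoDesign S) :
    ∃ T : Finset (unitaryGroup n ℂ), (T : Set (unitaryGroup n ℂ)) = S ∧ MatchesHaarMoments T := by
  obtain ⟨T, hT, h⟩ := hS
  refine ⟨T, hT, ?_⟩
  set τ : unitaryGroup n ℂ → Matrix (n × n) (n × n) ℂ → Matrix (n × n) (n × n) ℂ := fun U X =>
    ((U : Matrix n n ℂ) ⊗ₖ (U : Matrix n n ℂ)) * X * ((U : Matrix n n ℂ) ⊗ₖ (U : Matrix n n ℂ))ᴴ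
    with hτ
  have hint : ∀ X a b, Integrable (fun U => τ U X a b) (haarProb (unitaryGroup n ℂ)) :=
    fun X a b => integrable_haarProb ((continuous_kronecker_conj X).matrix_elem a b)
  have hall : ∀ X a b, (T.card : ℂ)⁻¹ * ∑ U ∈ T, τ U X a b
      = ∫ U, τ U X a b ∂(haarProb (unitaryGroup n ℂ)) := by
    intro X
    have hX : X ∈ Submodule.span ℂ {A : Matrix (n × n) (n × n) ℂ | A.PosSemidef} := by
      rw [span_posSemidef]; trivial
    induction hX using Submodule.span_induction with
    | mem X hX =>
      intro a b
      by_cases h0 : X.trace = 0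
      · simp [hτ, hX.trace_eq_zero_iff.mp h0]
      have hpos : 0 < X.trace := lt_of_le_of_ne hX.trace_nonneg (Ne.symm h0)
      have h1 := h ⟨X.trace⁻¹ • X, hX.smul (inv_nonneg.mpr hpos.le), by
        rw [trace_smul, smul_eq_mul, inv_mul_cancel₀ h0]⟩ a b
      have h2 : ∀ U, τ U (X.trace⁻¹ • X) a b = X.trace⁻¹ * τ U X a b := fun U => by simp [hτ]
      change (T.card : ℂ)⁻¹ * ∑ U ∈ T, τ U (X.trace⁻¹ • X) a b
        = ∫ U, τ U (X.trace⁻¹ • X) a b ∂(haarProb (unitaryGroup n ℂ)) at h1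
      simp only [h2, ← Finset.mul_sum, integral_const_mul] at h1
      rw [mul_left_comm] at h1
      exact mul_left_cancel₀ (inv_ne_zero h0) h1
    | zero => intro a b; simp [hτ]
    | add X Y _ _ hX hY =>
      intro a b
      have : ∀ U, τ U (X + Y) a b = τ U X a b + τ U Y a b := fun U => by simp [hτ, mul_add, add_mul]
      simp only [this, Finset.sum_add_distrib, mul_add, hX, hY]
      exact (integral_add (hint X a b) (hint Y a b)).symm
    | smul c X _ hX =>
      intro a b
      have : ∀ U, τ U (c • X) a b = c * τ U X a b := fun U => by simp [hτ]
      simp only [this, ← Finset.mul_sum, integral_const_mul, ← hX]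
      ring
  intro A B X Y
  have hexp : ∀ U, (A * unitaryConj U X).trace * (B * unitaryConj U Y).trace
      = ∑ a, ∑ b, (A ⊗ₖ B) a b * τ U (X ⊗ₖ Y) b a := fun U => by
    rw [← trace_kronecker_conj, trace_mul_eq_sum_sum]
  simp only [haarMoment, hexp]
  have hi : ∀ a b, Integrable (fun U => (A ⊗ₖ B) a b * τ U (X ⊗ₖ Y) b a)
      (haarProb (unitaryGroup n ℂ)) := fun a b => (hint (X ⊗ₖ Y) b a).const_mul _
  rw [integral_finsetSum _ fun a _ => integrable_finsetSum _ fun b _ => hi a b,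
    Finset.sum_comm, Finset.mul_sum]
  refine Finset.sum_congr rfl fun a _ => ?_
  rw [integral_finsetSum _ fun b _ => hi a b, Finset.sum_comm, Finset.mul_sum]
  refine Finset.sum_congr rfl fun b _ => ?_
  rw [integral_const_mul, ← hall, ← Finset.mul_sum]
  ring

section Rep

variable {K : Type*} [Group K] [TopologicalSpace K]

theorem ProjRep.unitaryConj_mul (V : ProjRep K n) (g h : K) (A : Matrix n n ℂ) :
    unitaryConj (V.toFun (g * h)) A = unitaryConj (V.toFun g) (unitaryConj (V.toFun h) A) := by
  obtain ⟨c, hc, h⟩ := V.map_mul g h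
  rw [unitaryConj, h, ← QEst.unitaryConj_mul, unitaryConj, conjTranspose_smul, Matrix.smul_mul,
    Matrix.smul_mul, Matrix.mul_smul, smul_smul, Complex.star_def, Complex.mul_conj', hc]
  simp

theorem ProjRep.continuous_unitaryConj (V : ProjRep K n) (A : Matrix n n ℂ) :
    Continuous fun g => unitaryConj (V.toFun g) A := V.continuous_conj A

variable [IsTopologicalGroup K] [CompactSpace K] [MeasurableSpace K] [BorelSpace K]

/-- If the image of a compact group contains a 2-design then its second moments are those of the
whole unitary group. -/
theorem ProjRep.integral_eq_haarMoment (V : ProjRep K n) {T : Finset (unitaryGroup n ℂ)}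
    (hT : MatchesHaarMoments T) (hT0 : T.Nonempty) (hTV : ∀ U ∈ T, ∃ h, V.toFun h = U)
    (A B X Y : Matrix n n ℂ) :
    ∫ g, (A * unitaryConj (V.toFun g) X).trace * (B * unitaryConj (V.toFun g) Y).trace
      ∂(haarProb K) = haarMoment A B X Y := by
  set F : unitaryGroup n ℂ → K → ℂ := fun U g =>
    (A * unitaryConj (V.toFun g) (unitaryConj U X)).trace
      * (B * unitaryConj (V.toFun g) (unitaryConj U Y)).trace with hF
  have hc : (T.card : ℂ) ≠ 0 := by exact_mod_cast hT0.card_pos.ne'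
  -- Right translation by the elements of `T` does not change the integral.
  have h1 : ∀ U ∈ T, ∫ g, F U g ∂(haarProb K)
      = ∫ g, (A * unitaryConj (V.toFun g) X).trace * (B * unitaryConj (V.toFun g) Y).trace
        ∂(haarProb K) := by
    intro U hU
    obtain ⟨h, rfl⟩ := hTV U hU
    simp only [hF, ← V.unitaryConj_mul]
    exact integral_mul_right_eq_self (fun g => (A * unitaryConj (V.toFun g) X).trace
      * (B * unitaryConj (V.toFun g) Y).trace) h
  have hint : ∀ U ∈ T, Integrable (F U) (haarProb K) := fun U _ => by
    have := V.continuous_unitaryConj (unitaryConj U X)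
    have := V.continuous_unitaryConj (unitaryConj U Y)
    exact integrable_haarProb (by fun_prop)
  have h2 : ∀ g, (T.card : ℂ)⁻¹ * ∑ U ∈ T, F U g = haarMoment A B X Y := by
    intro g
    rw [← haarMoment_conj_left (V.toFun g)⁻¹, ← hT]
    simp only [hF, trace_mul_unitaryConj (V.toFun g)]
  calc _ = (T.card : ℂ)⁻¹ * ∑ U ∈ T, ∫ g, F U g ∂(haarProb K) := by
        rw [Finset.sum_congr rfl h1, Finset.sum_const, nsmul_eq_mul, inv_mul_cancel_left₀ hc]
    _ = ∫ g, (T.card : ℂ)⁻¹ * ∑ U ∈ T, F U g ∂(haarProb K) := by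
        rw [integral_const_mul, integral_finsetSum _ hint]
    _ = haarMoment A B X Y := by simp [h2]

end Rep

end Twirl

/-! ### The posterior mean of a design prior -/

section Positivity

variable {n : Type*} [Fintype n]

theorem ofReal_re_trace_mul {A B : Matrix n n ℂ} (hA : A.IsHermitian) (hB : B.IsHermitian) :
    ((A * B).trace.re : ℂ) = (A * B).trace := by
  rw [← Complex.conj_eq_iff_re, starRingEnd_apply, ← trace_conjTranspose, conjTranspose_mul, hA.eq,
    hB.eq, trace_mul_comm]

theorem mulVec_eq_zero_of_sum_mulVec_eq_zero {ι : Type*} {s : Finset ι} {w : ι → ℝ}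
    {B : ι → Matrix n n ℂ} (hw : ∀ i ∈ s, 0 ≤ w i) (hB : ∀ i ∈ s, (B i).PosSemidef) {v : n → ℂ}
    (hv : (∑ i ∈ s, (w i : ℂ) • B i) *ᵥ v = 0) {i : ι} (hi : i ∈ s) (hwi : 0 < w i) :
    B i *ᵥ v = 0 := by
  have h1 : ∑ j ∈ s, (w j : ℂ) * (star v ⬝ᵥ B j *ᵥ v) = 0 := by
    have := congrArg (star v ⬝ᵥ ·) hv
    simpa [sum_mulVec, dotProduct_sum, smul_mulVec] using this
  have h2 := (Finset.sum_eq_zero_iff_of_nonneg fun j hj =>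
    mul_nonneg (by exact_mod_cast hw j hj) ((hB j hj).dotProduct_mulVec_nonneg v)).mp h1 i hi
  have h3 : (w i : ℂ) ≠ 0 := by exact_mod_cast hwi.ne'
  exact ((hB i hi).dotProduct_mulVec_zero_iff v).mp ((mul_eq_zero.mp h2).resolve_left h3)

end Positivity

section Posterior

variable {n : Type*} [Fintype n] [DecidableEq n]

theorem DensityMatrix.one_sub_posSemidef (ρ : DensityMatrix n) : (1 - ρ.val).PosSemidef := by
  have h := cfc_sub (fun _ => (1 : ℝ)) (fun t => t) ρ.val
    (ρ.val.finite_real_spectrum.continuousOn _) (ρ.val.finite_real_spectrum.continuousOn _)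
  rw [cfc_const_one ℝ _ ρ.isHermitian.isSelfAdjoint, cfc_id' ℝ _ ρ.isHermitian.isSelfAdjoint] at h
  rw [← h, cfc_eq_mul_diagonal_mul ρ.isHermitian]
  refine PosSemidef.mul_mul_conjTranspose_same (PosSemidef.diagonal fun k => ?_) _
  exact Complex.zero_le_real.mpr (sub_nonneg.mpr (ρ.eigenvalues_mem_Icc k).2)

theorem isHermitian_cfc {A : Matrix n n ℂ} (hA : A.IsHermitian) (h : ℝ → ℝ) :
    (cfc h A).IsHermitian := by
  rw [cfc_eq_mul_diagonal_mul hA]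
  refine isHermitian_mul_mul_conjTranspose _ (isHermitian_diagonal_iff.mpr fun k => ?_)
  exact Complex.conj_ofReal _

/-- The state `U ρ U†`. -/
def DensityMatrix.conj (U : unitaryGroup n ℂ) (ρ : DensityMatrix n) : DensityMatrix n :=
  ⟨unitaryConj U ρ.val, posSemidef_unitaryConj U ρ.posSemidef, by
    rw [trace_unitaryConj, ρ.trace_eq_one]⟩

/-- The (unnormalized) mean of the states `U ρ U†`, for uniformly distributed `U ∈ T`, after an
outcome represented by the operator `A`. -/
noncomputable def posteriorMean (T : Finset (unitaryGroup n ℂ)) (ρ : DensityMatrix n)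
    (A : Matrix n n ℂ) : Matrix n n ℂ :=
  (T.card : ℂ)⁻¹ • ∑ U ∈ T, (A * unitaryConj U ρ.val).trace • unitaryConj U ρ.val

variable {T : Finset (unitaryGroup n ℂ)}

theorem trace_mul_posteriorMean (hT : MatchesHaarMoments T) (ρ : DensityMatrix n)
    (A B : Matrix n n ℂ) :
    (B * posteriorMean T ρ A).trace = haarMoment A B ρ.val ρ.val := by
  rw [posteriorMean, ← hT]
  simp only [Matrix.mul_smul, Finset.mul_sum, trace_smul, trace_sum, smul_eq_mul]

theorem posteriorMean_unitaryConj (hT : MatchesHaarMoments T) (ρ : DensityMatrix n)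
    (W : unitaryGroup n ℂ) (A : Matrix n n ℂ) :
    posteriorMean T ρ (unitaryConj W A) = unitaryConj W (posteriorMean T ρ A) := by
  refine ext_iff_trace_mul_left.mpr fun B => ?_
  rw [trace_mul_posteriorMean hT, trace_mul_unitaryConj, trace_mul_posteriorMean hT,
    ← haarMoment_conj_left W A, ← unitaryConj_mul, mul_inv_cancel, unitaryConj_one]

theorem posteriorMean_conj (hT : MatchesHaarMoments T) (ρ : DensityMatrix n)
    (W : unitaryGroup n ℂ) (A : Matrix n n ℂ) :
    posteriorMean T (ρ.conj W) A = posteriorMean T ρ A := by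
  refine ext_iff_trace_mul_left.mpr fun B => ?_
  rw [trace_mul_posteriorMean hT, trace_mul_posteriorMean hT]
  exact haarMoment_conj_right W A B _ _

/-- The joint weight of the state `U ρ U†` and the outcome represented by `A`. -/
noncomputable def posteriorWeight (T : Finset (unitaryGroup n ℂ)) (ρ : DensityMatrix n)
    (A : Matrix n n ℂ) (U : unitaryGroup n ℂ) : ℝ :=
  (T.card : ℝ)⁻¹ * (A * unitaryConj U ρ.val).trace.re

theorem posteriorWeight_nonneg (ρ : DensityMatrix n) {A : Matrix n n ℂ} (hA : A.PosSemidef)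
    (U : unitaryGroup n ℂ) : 0 ≤ posteriorWeight T ρ A U :=
  mul_nonneg (by positivity) (trace_mul_nonneg hA (posSemidef_unitaryConj U ρ.posSemidef))

theorem posteriorMean_eq_sum (ρ : DensityMatrix n) {A : Matrix n n ℂ} (hA : A.PosSemidef) :
    posteriorMean T ρ A = ∑ U ∈ T, (posteriorWeight T ρ A U : ℂ) • unitaryConj U ρ.val := by
  rw [posteriorMean, Finset.smul_sum]
  refine Finset.sum_congr rfl fun U _ => ?_
  rw [posteriorWeight, smul_smul, ← ofReal_re_trace_mul hA.1
    (posSemidef_unitaryConj U ρ.posSemidef).1]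
  push_cast
  rfl

theorem posteriorMean_posSemidef (ρ : DensityMatrix n) {A : Matrix n n ℂ} (hA : A.PosSemidef) :
    (posteriorMean T ρ A).PosSemidef := by
  rw [posteriorMean_eq_sum ρ hA]
  refine posSemidef_sum _ fun U _ => (posSemidef_unitaryConj U ρ.posSemidef).smul ?_
  exact_mod_cast posteriorWeight_nonneg ρ hA U

theorem sum_posteriorWeight (ρ : DensityMatrix n) {A : Matrix n n ℂ} (hA : A.PosSemidef)
    (htr : (posteriorMean T ρ A).trace = 1) : ∑ U ∈ T, posteriorWeight T ρ A U = 1 := by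
  rw [posteriorMean_eq_sum ρ hA, trace_sum] at htr
  simp only [trace_smul, trace_unitaryConj, ρ.trace_eq_one, smul_eq_mul, mul_one] at htr
  exact_mod_cast htr

/-- The posterior mean as a state. -/
noncomputable def posteriorState (T : Finset (unitaryGroup n ℂ)) (ρ : DensityMatrix n)
    {A : Matrix n n ℂ} (hA : A.PosSemidef) (htr : (posteriorMean T ρ A).trace = 1) :
    DensityMatrix n :=
  ⟨posteriorMean T ρ A, posteriorMean_posSemidef ρ hA, htr⟩

/-- The expected loss of the posterior mean: the amount by which `Tr f` at the states `U ρ U†`, which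
is the same for all of them, exceeds `Tr f` at the posterior mean. -/
noncomputable def bayesRisk (f : ℝ → ℝ) (T : Finset (unitaryGroup n ℂ)) (ρ : DensityMatrix n)
    (A : Matrix n n ℂ) : ℝ≥0∞ :=
  ENNReal.ofReal (traceFun f ρ.val - traceFun f (posteriorMean T ρ A))

/-- For a Bregman divergence the posterior mean is the best guess: given an outcome represented by
`A`, no state `σ` has a smaller expected loss than the posterior mean. The excess is the divergence
of `σ` from the posterior mean, which is nonnegative by Klein's inequality. -/
theorem bayesRisk_le {f : ℝ → ℝ} (hf : IsBregmanGenerator f) (hT0 : T.Nonempty)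
    (ρ : DensityMatrix n) {A : Matrix n n ℂ} (hA : A.PosSemidef)
    (htr : (posteriorMean T ρ A).trace = 1) (σ : DensityMatrix n) :
    bayesRisk f T ρ A ≤ ∑ U ∈ T, (T.card : ℝ≥0∞)⁻¹ *
      (bregman f (ρ.conj U) σ * ENNReal.ofReal (A * unitaryConj U ρ.val).trace.re) := by
  set w := posteriorWeight T ρ A with hw
  have hw0 : ∀ U, 0 ≤ w U := posteriorWeight_nonneg ρ hA
  have hc : (0 : ℝ) < T.card := by exact_mod_cast hT0.card_pos
  have hterm : ∀ U, (T.card : ℝ≥0∞)⁻¹ *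
      (bregman f (ρ.conj U) σ * ENNReal.ofReal (A * unitaryConj U ρ.val).trace.re)
      = bregman f (ρ.conj U) σ * ENNReal.ofReal (w U) := fun U => by
    rw [hw, posteriorWeight, ENNReal.ofReal_mul (by positivity), ENNReal.ofReal_inv_of_pos hc,
      ENNReal.ofReal_natCast, mul_left_comm]
  simp only [hterm]
  by_cases hfin : ∀ U ∈ T, 0 < w U → BregmanFinite f (ρ.conj U).val σ.val
  swap
  · push Not at hfin
    obtain ⟨U, hU, hpos, hnot⟩ := hfin
    refine le_trans ?_ (Finset.single_le_sum (fun _ _ => zero_le) hU)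
    rw [bregman_of_not_finite hnot, ENNReal.top_mul (ENNReal.ofReal_pos.mpr hpos).ne']
    exact le_top
  have hm := posteriorMean_eq_sum (T := T) ρ hA
  set m := posteriorState T ρ hA htr with hmdef
  have hmv : m.val = ∑ U ∈ T, (w U : ℂ) • unitaryConj U ρ.val := hm
  have hw1 : ∑ U ∈ T, w U = 1 := sum_posteriorWeight ρ hA htr
  have hmfin : BregmanFinite f m.val σ.val := by
    intro q hq v hv
    have : ∀ U ∈ T, ((w U : ℂ) • unitaryConj U ρ.val) *ᵥ v = (w U : ℂ) • (q : ℂ) • v := by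
      intro U hU
      rcases (hw0 U).eq_or_lt with h0 | h0
      · simp [← h0]
      · rw [smul_mulVec]
        exact congrArg _ (hfin U hU h0 q hq v hv)
    rw [hmv, sum_mulVec, Finset.sum_congr rfl this, ← Finset.sum_smul]
    rw [← Complex.ofReal_sum, hw1, Complex.ofReal_one, one_smul]
  have hterm0 : ∀ U ∈ T, 0 ≤ w U * bregmanReal f (ρ.conj U).val σ.val := by
    intro U hU
    rcases (hw0 U).eq_or_lt with h0 | h0
    · simp [← h0]
    · exact mul_nonneg h0.le (bregmanReal_nonneg hf (hfin U hU h0))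
  have hsum : ∑ U ∈ T, bregman f (ρ.conj U) σ * ENNReal.ofReal (w U)
      = ENNReal.ofReal (∑ U ∈ T, w U * bregmanReal f (ρ.conj U).val σ.val) := by
    rw [ENNReal.ofReal_sum_of_nonneg hterm0]
    refine Finset.sum_congr rfl fun U hU => ?_
    rcases (hw0 U).eq_or_lt with h0 | h0
    · simp [← h0]
    · rw [bregman_of_finite (hfin U hU h0), ENNReal.ofReal_mul (hw0 U), mul_comm]
  rw [hsum, bayesRisk]
  refine ENNReal.ofReal_le_ofReal ?_
  set D := cfc (derivWithin f (Set.Icc 0 1)) σ.val with hD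
  have hlin : ∑ U ∈ T, w U * (D * ((ρ.conj U).val - σ.val)).trace.re
      = (D * (m.val - σ.val)).trace.re := by
    have : D * (m.val - σ.val) = ∑ U ∈ T, (w U : ℂ) • (D * ((ρ.conj U).val - σ.val)) := by
      have h1 : σ.val = ∑ U ∈ T, (w U : ℂ) • σ.val := by
        rw [← Finset.sum_smul, ← Complex.ofReal_sum, hw1, Complex.ofReal_one, one_smul]
      conv_lhs => rw [hmv, h1, ← Finset.sum_sub_distrib, Finset.mul_sum]
      refine Finset.sum_congr rfl fun U _ => ?_
      rw [← smul_sub, Matrix.mul_smul]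
      rfl
    rw [this, trace_sum, Complex.re_sum]
    refine Finset.sum_congr rfl fun U _ => ?_
    rw [trace_smul, smul_eq_mul, Complex.re_ofReal_mul]
  have hF : ∀ U, traceFun f (ρ.conj U).val = traceFun f ρ.val := fun U =>
    traceFun_conj_unitary f U ρ.isHermitian
  have htot : ∑ U ∈ T, w U * bregmanReal f (ρ.conj U).val σ.val
      = traceFun f ρ.val - traceFun f m.val + bregmanReal f m.val σ.val := by
    simp only [bregmanReal, hF, mul_sub (w _), Finset.sum_sub_distrib, ← Finset.sum_mul, hw1]
    rw [hlin]
    ring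
  rw [htot]
  have := bregmanReal_nonneg hf hmfin
  change traceFun f ρ.val - traceFun f m.val ≤ _
  linarith

/-- The loss at the posterior mean is finite for every state which has a positive posterior
density. By right invariance of the second moments the prior may be translated so that it charges
the given state. -/
theorem bregmanFinite_posteriorMean {f : ℝ → ℝ} (hf : IsBregmanGenerator f)
    (hT : MatchesHaarMoments T) (hT0 : T.Nonempty) (ρ : DensityMatrix n) {A : Matrix n n ℂ}
    (hA : A.PosSemidef) (htr : (posteriorMean T ρ A).trace = 1)
    (hpos : 0 < (A * ρ.val).trace.re) : BregmanFinite f ρ.val (posteriorMean T ρ A) := by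
  obtain ⟨U₀, hU₀⟩ := hT0
  rw [← posteriorMean_conj hT ρ U₀⁻¹] at htr ⊢
  set τ := ρ.conj U₀⁻¹ with hτ
  have hτρ : unitaryConj U₀ τ.val = ρ.val := by
    change unitaryConj U₀ (unitaryConj U₀⁻¹ ρ.val) = _
    rw [← unitaryConj_mul, mul_inv_cancel, unitaryConj_one]
  have hwpos : 0 < posteriorWeight T τ A U₀ := by
    rw [posteriorWeight, hτρ]
    have : 0 < T.card := Finset.card_pos.mpr ⟨U₀, hU₀⟩
    positivity
  have hw0 : ∀ U ∈ T, 0 ≤ posteriorWeight T τ A U := fun U _ => posteriorWeight_nonneg τ hA U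
  have hm := posteriorMean_eq_sum (T := T) τ hA
  have hw1 := sum_posteriorWeight τ hA htr
  intro q hq v hv
  by_cases h0 : q = 0
  · subst h0
    rw [hm] at hv
    simp only [Complex.ofReal_zero, zero_smul] at hv ⊢
    rw [← hτρ]
    exact mulVec_eq_zero_of_sum_mulVec_eq_zero hw0
      (fun U _ => posSemidef_unitaryConj U τ.posSemidef) hv hU₀ hwpos
  by_cases h1 : q = 1
  · subst h1
    simp only [Complex.ofReal_one, one_smul] at hv ⊢
    have hv' : (∑ U ∈ T, (posteriorWeight T τ A U : ℂ) • (1 - unitaryConj U τ.val)) *ᵥ v = 0 := by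
      simp only [smul_sub, Finset.sum_sub_distrib, ← hm, ← Finset.sum_smul, ← Complex.ofReal_sum,
        hw1, Complex.ofReal_one, one_smul, sub_mulVec, one_mulVec, hv, sub_self]
    have := mulVec_eq_zero_of_sum_mulVec_eq_zero hw0
      (fun U _ => (τ.conj U).one_sub_posSemidef) hv' hU₀ hwpos
    change (1 - unitaryConj U₀ τ.val) *ᵥ v = 0 at this
    rw [hτρ, sub_mulVec, one_mulVec, sub_eq_zero] at this
    exact this.symm
  exact absurd (hf.differentiableWithinAt h0 h1) hq

variable {K : Type*} [Group K] [TopologicalSpace K] [IsTopologicalGroup K] [CompactSpace K]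
  [MeasurableSpace K] [BorelSpace K]

/-- The expected loss of the covariant estimator `g ↦ V_g m V_g†`, where `m` is the posterior mean
for the seed `A`, is the Bayes risk. The integrand is of second degree in `V_g ⊗ V_g†`, so the group
enters only through the second moments of the Haar measure. -/
theorem lintegral_bregman_posteriorState {f : ℝ → ℝ} (hf : IsBregmanGenerator f)
    (hT : MatchesHaarMoments T) (V : ProjRep K n) (hT0 : T.Nonempty)
    (hTV : ∀ U ∈ T, ∃ h, V.toFun h = U) (ρ : DensityMatrix n) {A : Matrix n n ℂ}
    (hA : A.PosSemidef) (htr : (posteriorMean T ρ A).trace = 1) :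
    ∫⁻ g, bregman f ρ ((posteriorState T ρ hA htr).conj (V.toFun g))
      * ENNReal.ofReal (unitaryConj (V.toFun g) A * ρ.val).trace.re ∂(haarProb K)
      = bayesRisk f T ρ A := by
  set m := posteriorState T ρ hA htr with hm
  set D := cfc (derivWithin f (Set.Icc 0 1)) m.val with hD
  have hDh : D.IsHermitian := isHermitian_cfc m.isHermitian _
  set c := traceFun f ρ.val - traceFun f m.val + (D * m.val).trace.re with hc
  set G : K → ℝ := fun g => (c - (ρ.val * unitaryConj (V.toFun g) D).trace.re)
    * (ρ.val * unitaryConj (V.toFun g) A).trace.re with hG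
  have hmg : ∀ g, (m.conj (V.toFun g)).val = posteriorMean T ρ (unitaryConj (V.toFun g) A) :=
    fun g => (posteriorMean_unitaryConj hT ρ _ A).symm
  have hreal : ∀ g, bregmanReal f ρ.val (m.conj (V.toFun g)).val
      = c - (ρ.val * unitaryConj (V.toFun g) D).trace.re := by
    intro g
    have h1 : cfc (derivWithin f (Set.Icc 0 1)) (m.conj (V.toFun g)).val
        = unitaryConj (V.toFun g) D := cfc_conj_unitary _ m.isHermitian _
    have h2 : traceFun f (m.conj (V.toFun g)).val = traceFun f m.val :=
      traceFun_conj_unitary f _ m.isHermitian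
    have h3 : (unitaryConj (V.toFun g) D * (m.conj (V.toFun g)).val).trace = (D * m.val).trace := by
      rw [trace_unitaryConj_mul]
      change (D * unitaryConj _ (unitaryConj _ m.val)).trace = _
      rw [← unitaryConj_mul, inv_mul_cancel, unitaryConj_one]
    rw [bregmanReal, h1, h2, mul_sub, trace_sub, Complex.sub_re, h3, trace_mul_comm ρ.val, hc]
    ring
  have hpt : ∀ g, 0 ≤ G g ∧ bregman f ρ (m.conj (V.toFun g))
      * ENNReal.ofReal (unitaryConj (V.toFun g) A * ρ.val).trace.re = ENNReal.ofReal (G g) := by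
    intro g
    have hAg := posSemidef_unitaryConj (V.toFun g) hA
    have hGg : G g = bregmanReal f ρ.val (m.conj (V.toFun g)).val
        * (unitaryConj (V.toFun g) A * ρ.val).trace.re := by
      rw [hreal, trace_mul_comm (unitaryConj _ A)]
    rcases (trace_mul_nonneg hAg ρ.posSemidef).eq_or_lt with h0 | h0
    · simp [hGg, ← h0]
    have hfin : BregmanFinite f ρ.val (m.conj (V.toFun g)).val := by
      rw [hmg]
      refine bregmanFinite_posteriorMean hf hT hT0 ρ hAg ?_ h0
      rw [← hmg, (m.conj _).trace_eq_one]
    have hk := bregmanReal_nonneg hf hfin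
    exact ⟨hGg ▸ mul_nonneg hk h0.le, by rw [bregman_of_finite hfin, hGg, ENNReal.ofReal_mul hk]⟩
  have hcD := V.continuous_unitaryConj D
  have hcA := V.continuous_unitaryConj A
  have hGi : Integrable G (haarProb K) := integrable_haarProb (by fun_prop)
  simp only [fun g => (hpt g).2]
  rw [← ofReal_integral_eq_lintegral_ofReal hGi (Filter.Eventually.of_forall fun g => (hpt g).1),
    bayesRisk]
  congr 1
  apply Complex.ofReal_injective
  have hGc : ∀ g, (G g : ℂ) = c * ((ρ.val * unitaryConj (V.toFun g) A).trace
        * (ρ.val * unitaryConj (V.toFun g) 1).trace)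
      - (ρ.val * unitaryConj (V.toFun g) A).trace * (ρ.val * unitaryConj (V.toFun g) D).trace := by
    intro g
    have h1 : unitaryConj (V.toFun g) 1 = 1 := by
      simpa [unitaryConj, star_eq_conjTranspose] using mem_unitaryGroup_iff.mp (V.toFun g).2
    have h2 := ofReal_re_trace_mul ρ.isHermitian (posSemidef_unitaryConj (V.toFun g) hA).1
    have h3 : ((ρ.val * unitaryConj (V.toFun g) D).trace.re : ℂ)
        = (ρ.val * unitaryConj (V.toFun g) D).trace :=
      ofReal_re_trace_mul ρ.isHermitian (isHermitian_mul_mul_conjTranspose _ hDh)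
    rw [h1, mul_one, ρ.trace_eq_one, mul_one, ← h2, ← h3, hG]
    push_cast
    ring
  have hc1 := V.continuous_unitaryConj 1
  rw [← integral_complex_ofReal, integral_congr_ae (Filter.Eventually.of_forall hGc), integral_sub
    (integrable_haarProb (by fun_prop)) (integrable_haarProb (by fun_prop)), integral_const_mul,
    V.integral_eq_haarMoment hT hT0 hTV, V.integral_eq_haarMoment hT hT0 hTV,
    haarMoment_symm, haarMoment_symm _ _ A D, ← trace_mul_posteriorMean hT,
    ← trace_mul_posteriorMean hT, one_mul, htr, mul_one, hc]
  have h4 := ofReal_re_trace_mul hDh m.isHermitian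
  change _ - (D * m.val).trace = _
  push_cast
  rw [h4]
  change _ = (traceFun f ρ.val : ℂ) - (traceFun f m.val : ℂ)
  ring

end Posterior

/-! ### Measurements with a seed -/

theorem continuousOn_range_of_continuous_comp {K X Y : Type*} [TopologicalSpace K] [CompactSpace K]
    [TopologicalSpace X] [T2Space X] [TopologicalSpace Y] {φ : K → X} (hφ : Continuous φ)
    {h : X → Y} (hh : Continuous (h ∘ φ)) : ContinuousOn h (Set.range φ) := by
  refine continuousOn_iff_isClosed.mpr fun t ht => ⟨φ '' ((h ∘ φ) ⁻¹' t), ?_, ?_⟩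
  · exact ((ht.preimage hh).isCompact.image hφ).isClosed
  · ext x
    constructor
    · rintro ⟨hx, k, rfl⟩
      exact ⟨⟨k, hx, rfl⟩, k, rfl⟩
    · rintro ⟨⟨k, hk, rfl⟩, hx⟩
      exact ⟨hk, hx⟩

section Seed

variable {n : Type*} [Fintype n] [DecidableEq n] {K : Type*} [Group K] [TopologicalSpace K]
  [IsTopologicalGroup K] [CompactSpace K] [MeasurableSpace K] [BorelSpace K] {Θ : Type*}
  [MulAction K Θ] [TopologicalSpace Θ] [T2Space Θ] [MeasurableSpace Θ] [BorelSpace Θ]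
  {V : ProjRep K n} {θ₀ : Θ} {P : POVM Θ n} {P₀ : Matrix n n ℂ}

/-- The effect of a set under a measurement with a seed, as an integral over the group. -/
theorem HasSeed.meas_apply (hP : HasSeed V θ₀ P P₀) (hc : Continuous fun g : K => g • θ₀)
    {B : Set Θ} (hB : MeasurableSet B) (i j : n) :
    P.meas B i j = ∫ g in (fun g : K => g • θ₀) ⁻¹' B, unitaryConj (V.toFun g) P₀ i j
      ∂(haarProb K) := by
  obtain ⟨-, p, hp, hPB⟩ := hP
  have hcomp : (fun θ => p θ i j) ∘ (fun g : K => g • θ₀)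
      = fun g => unitaryConj (V.toFun g) P₀ i j := by
    ext g
    exact congrFun (congrFun (hp g) i) j
  have hcont : ContinuousOn (fun θ => p θ i j) (Set.range fun g : K => g • θ₀) :=
    continuousOn_range_of_continuous_comp hc (by
      rw [hcomp]; exact (V.continuous_unitaryConj P₀).matrix_elem i j)
  have hmeas : MeasurableSet (Set.range fun g : K => g • θ₀) := (isCompact_range hc).measurableSet
  have hν : (orbitMeasure K θ₀).restrict (Set.range fun g : K => g • θ₀) = orbitMeasure K θ₀ := by
    rw [Measure.restrict_eq_self_of_ae_mem]
    refine (ae_map_iff hc.aemeasurable hmeas).mpr ?_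
    exact Filter.Eventually.of_forall fun g => ⟨g, rfl⟩
  have hsm : AEStronglyMeasurable (fun θ => p θ i j) (orbitMeasure K θ₀) := by
    rw [← hν]
    exact hcont.aestronglyMeasurable hmeas
  rw [hPB B hB, orbitMeasure, setIntegral_map hB hsm hc.aemeasurable]
  exact integral_congr_ae (Filter.Eventually.of_forall fun g => congrFun hcomp g)

/-- The density of the outcome distribution of a measurement with a seed. -/
theorem HasSeed.born_eq (hP : HasSeed V θ₀ P P₀) (hc : Continuous fun g : K => g • θ₀)
    (ρ : DensityMatrix n) :
    born P ρ = ((haarProb K).withDensity fun g =>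
      ENNReal.ofReal (unitaryConj (V.toFun g) P₀ * ρ.val).trace.re).map fun g => g • θ₀ := by
  have hcV := V.continuous_unitaryConj P₀
  ext B hB
  have hB' := hc.measurable hB
  rw [born_apply P ρ hB, Measure.map_apply hc.measurable hB, withDensity_apply _ hB',
    ← ofReal_integral_eq_lintegral_ofReal (integrable_haarProb (by fun_prop)).integrableOn
      (Filter.Eventually.of_forall fun g =>
        trace_mul_nonneg (posSemidef_unitaryConj _ hP.1) ρ.posSemidef)]
  congr 1
  have hi : ∀ a b, Integrable (fun g => unitaryConj (V.toFun g) P₀ a b * ρ.val b a)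
      ((haarProb K).restrict ((fun g : K => g • θ₀) ⁻¹' B)) := fun a b =>
    (integrable_haarProb ((hcV.matrix_elem a b).mul continuous_const)).integrableOn
  have h1 : (P.meas B * ρ.val).trace = ∫ g in (fun g : K => g • θ₀) ⁻¹' B,
      (unitaryConj (V.toFun g) P₀ * ρ.val).trace ∂(haarProb K) := by
    simp only [trace_mul_eq_sum_sum]
    rw [integral_finsetSum _ fun a _ => integrable_finsetSum _ fun b _ => hi a b]
    refine Finset.sum_congr rfl fun a _ => ?_
    rw [integral_finsetSum _ fun b _ => hi a b]
    refine Finset.sum_congr rfl fun b _ => ?_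
    rw [hP.meas_apply hc hB, integral_mul_const]
  rw [h1]
  exact (integral_re (𝕜 := ℂ) (integrable_haarProb (by fun_prop)).integrableOn).symm

theorem HasSeed.risk_eq (hP : HasSeed V θ₀ P P₀) (hc : Continuous fun g : K => g • θ₀)
    {f : ℝ → ℝ} (hf : IsBregmanGenerator f) (ρ : DensityMatrix n) (e : Estimator Θ n) :
    risk f P ρ e = ∫⁻ g, bregman f ρ (e.toFun (g • θ₀))
      * ENNReal.ofReal (unitaryConj (V.toFun g) P₀ * ρ.val).trace.re ∂(haarProb K) := by
  have hcV := V.continuous_unitaryConj P₀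
  have hm : Measurable fun g => ENNReal.ofReal (unitaryConj (V.toFun g) P₀ * ρ.val).trace.re :=
    ENNReal.measurable_ofReal.comp (Continuous.measurable (by fun_prop))
  have hb : Measurable fun g : K => bregman f ρ (e.toFun (g • θ₀)) :=
    (measurable_bregman hf ρ e).comp hc.measurable
  rw [risk, hP.born_eq hc, lintegral_map (measurable_bregman hf ρ e) hc.measurable,
    lintegral_withDensity_eq_lintegral_mul _ hm hb]
  simp only [Pi.mul_apply, mul_comm]

variable {T : Finset (unitaryGroup n ℂ)}

/-- The posterior mean has trace one, because the effects of the measurement sum up to one. -/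
theorem HasSeed.trace_posteriorMean (hP : HasSeed V θ₀ P P₀)
    (hc : Continuous fun g : K => g • θ₀) (hT : MatchesHaarMoments T) (hT0 : T.Nonempty)
    (hTV : ∀ U ∈ T, ∃ h, V.toFun h = U) (ρ : DensityMatrix n) :
    (posteriorMean T ρ P₀).trace = 1 := by
  have hcV := V.continuous_unitaryConj P₀
  have h1 : ∀ g, unitaryConj (V.toFun g) 1 = 1 := fun g => by
    simpa [unitaryConj, star_eq_conjTranspose] using mem_unitaryGroup_iff.mp (V.toFun g).2
  have hi : ∀ a b, Integrable (fun g => ρ.val a b * unitaryConj (V.toFun g) P₀ b a)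
      (haarProb K) := fun a b =>
    integrable_haarProb (continuous_const.mul (hcV.matrix_elem b a))
  rw [← one_mul (posteriorMean T ρ P₀), trace_mul_posteriorMean hT, haarMoment_symm,
    ← V.integral_eq_haarMoment hT hT0 hTV]
  simp only [h1, mul_one, ρ.trace_eq_one]
  simp only [trace_mul_eq_sum_sum]
  rw [integral_finsetSum _ fun a _ => integrable_finsetSum _ fun b _ => hi a b]
  have h2 : ∀ a b, ∫ g, ρ.val a b * unitaryConj (V.toFun g) P₀ b a ∂(haarProb K)
      = ρ.val a b * (1 : Matrix n n ℂ) b a := by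
    intro a b
    rw [integral_const_mul, ← P.total, hP.meas_apply hc MeasurableSet.univ, Set.preimage_univ,
      Measure.restrict_univ]
  have h3 : ∀ a, ∫ g, ∑ b, ρ.val a b * unitaryConj (V.toFun g) P₀ b a ∂(haarProb K)
      = ∑ b, ρ.val a b * (1 : Matrix n n ℂ) b a := by
    intro a
    rw [integral_finsetSum _ fun b _ => hi a b]
    exact Finset.sum_congr rfl fun b _ => h2 a b
  rw [Finset.sum_congr rfl fun a _ => h3 a, ← trace_mul_eq_sum_sum, mul_one, ρ.trace_eq_one]

/-- The estimator which answers with the posterior mean for the effect density at the outcome. -/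
theorem HasSeed.exists_covariant_estimator (hP : HasSeed V θ₀ P P₀)
    (hc : Continuous fun g : K => g • θ₀) (hT : MatchesHaarMoments T) (ρ : DensityMatrix n)
    (htr : (posteriorMean T ρ P₀).trace = 1) :
    ∃ e : Estimator Θ n, ∀ g : K,
      e.toFun (g • θ₀) = (posteriorState T ρ hP.1 htr).conj (V.toFun g) := by
  classical
  obtain ⟨hP₀, p, hp, -⟩ := id hP
  set m := posteriorState T ρ hP.1 htr
  have hch : ∀ θ, θ ∈ Set.range (fun g : K => g • θ₀) → ∃ g : K, g • θ₀ = θ := fun θ h => h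
  set S := Set.range fun g : K => g • θ₀
  -- The value at `g • θ₀` does not depend on `g`, as it is a function of `p (g • θ₀)`.
  have hval : ∀ g : K, ((m.conj (V.toFun g)).val) = posteriorMean T ρ (p (g • θ₀)) := by
    intro g
    rw [hp g]
    exact (posteriorMean_unitaryConj hT ρ (V.toFun g) P₀).symm
  let E : Θ → DensityMatrix n := fun θ =>
    if h : θ ∈ S then m.conj (V.toFun (hch θ h).choose) else m
  have hE : ∀ g : K, E (g • θ₀) = m.conj (V.toFun g) := by
    intro g
    have hg : g • θ₀ ∈ S := ⟨g, rfl⟩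
    have h1 : E (g • θ₀) = m.conj (V.toFun (hch _ hg).choose) := dif_pos hg
    have h2 : (E (g • θ₀)).val = (m.conj (V.toFun g)).val := by
      rw [h1, hval, hval, (hch _ hg).choose_spec]
    exact DensityMatrix.ext' h2
  refine ⟨⟨E, fun i j => ?_⟩, hE⟩
  have hmeas : MeasurableSet S := (isCompact_range hc).measurableSet
  have hcont : ContinuousOn (fun θ => (E θ).val i j) S := by
    refine continuousOn_range_of_continuous_comp hc ?_
    simp only [Function.comp_def, hE]
    exact (V.continuous_unitaryConj m.val).matrix_elem i j
  have := hcont.measurable_piecewise (g := fun _ => m.val i j) continuousOn_const hmeas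
  convert this using 1
  ext θ
  by_cases h : θ ∈ S
  · simp [h]
  · simp [h, E]

/-- A measurement with seed `P₀`, for a representation whose image contains a 2-design, attains the
Bayes risk uniformly over the orbit of `ρ₀`. -/
theorem HasSeed.minimaxRisk_le (hP : HasSeed V θ₀ P P₀) (hc : Continuous fun g : K => g • θ₀)
    {f : ℝ → ℝ} (hf : IsBregmanGenerator f) (hT : MatchesHaarMoments T) (hT0 : T.Nonempty)
    (hTV : ∀ U ∈ T, ∃ h, V.toFun h = U) {ι : Type*} (ρ : ι → DensityMatrix n)
    (ρ₀ : DensityMatrix n) (hρ : ∀ i, ∃ W, ρ i = ρ₀.conj W) :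
    minimaxRisk f ρ P ≤ bayesRisk f T ρ₀ P₀ := by
  have htr := hP.trace_posteriorMean hc hT hT0 hTV ρ₀
  obtain ⟨e, he⟩ := hP.exists_covariant_estimator hc hT ρ₀ htr
  refine (iInf_le _ e).trans (iSup_le fun i => ?_)
  obtain ⟨W, hW⟩ := hρ i
  have hpm : posteriorMean T (ρ i) P₀ = posteriorMean T ρ₀ P₀ := by
    rw [hW, posteriorMean_conj hT]
  have htr' : (posteriorMean T (ρ i) P₀).trace = 1 := by rw [hpm, htr]
  have hps : posteriorState T ρ₀ hP.1 htr = posteriorState T (ρ i) hP.1 htr' := by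
    simp only [posteriorState, hpm]
  have hb : bayesRisk f T (ρ i) P₀ = bayesRisk f T ρ₀ P₀ := by
    rw [bayesRisk, hpm, hW]
    change ENNReal.ofReal (traceFun f (unitaryConj W ρ₀.val) - _) = _
    rw [unitaryConj, traceFun_conj_unitary f W ρ₀.isHermitian, bayesRisk]
  rw [hP.risk_eq hc hf, ← hb, ← lintegral_bregman_posteriorState hf hT V hT0 hTV (ρ i) hP.1 htr']
  simp only [he, hps, le_refl]

/-- The average of the risk over a finite prior is a lower bound for the maximal risk. -/
theorem sum_risk_le_iSup_risk {X ι : Type*} [MeasurableSpace X] (hT0 : T.Nonempty) (f : ℝ → ℝ)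
    (Q : POVM X n) (ρ : ι → DensityMatrix n) (ρ₀ : DensityMatrix n)
    (hρ : ∀ U ∈ T, ∃ i, ρ i = ρ₀.conj U) (e : Estimator X n) :
    ∑ U ∈ T, (T.card : ℝ≥0∞)⁻¹ * risk f Q (ρ₀.conj U) e ≤ ⨆ i, risk f Q (ρ i) e := by
  have h1 : ∀ U ∈ T, (T.card : ℝ≥0∞)⁻¹ * risk f Q (ρ₀.conj U) e
      ≤ (T.card : ℝ≥0∞)⁻¹ * ⨆ i, risk f Q (ρ i) e := by
    intro U hU
    obtain ⟨i, hi⟩ := hρ U hU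
    rw [← hi]
    gcongr
    exact le_iSup (fun i => risk f Q (ρ i) e) i
  refine (Finset.sum_le_sum h1).trans ?_
  rw [Finset.sum_const, nsmul_eq_mul, ← mul_assoc, ENNReal.mul_inv_cancel
    (by exact_mod_cast hT0.card_pos.ne') (ENNReal.natCast_ne_top _), one_mul]

theorem bayesRisk_unitaryConj (hT : MatchesHaarMoments T) (f : ℝ → ℝ) (ρ : DensityMatrix n)
    (W : unitaryGroup n ℂ) {A : Matrix n n ℂ} (hA : A.PosSemidef) :
    bayesRisk f T ρ (unitaryConj W A) = bayesRisk f T ρ A := by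
  rw [bayesRisk, posteriorMean_unitaryConj hT, unitaryConj,
    traceFun_conj_unitary f W (posteriorMean_posSemidef ρ hA).1, bayesRisk]

/-- No estimator for a measurement with seed `P₀` does better than the Bayes risk. -/
theorem HasSeed.bayesRisk_le_minimaxRisk (hP : HasSeed V θ₀ P P₀)
    (hc : Continuous fun g : K => g • θ₀) {f : ℝ → ℝ} (hf : IsBregmanGenerator f)
    (hT : MatchesHaarMoments T) (hT0 : T.Nonempty) (hTV : ∀ U ∈ T, ∃ h, V.toFun h = U)
    {ι : Type*} (ρ : ι → DensityMatrix n) (ρ₀ : DensityMatrix n)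
    (hρ : ∀ U ∈ T, ∃ i, ρ i = ρ₀.conj U) :
    bayesRisk f T ρ₀ P₀ ≤ minimaxRisk f ρ P := by
  have htr := hP.trace_posteriorMean hc hT hT0 hTV ρ₀
  have hcV := V.continuous_unitaryConj P₀
  refine le_iInf fun e => le_trans ?_ (sum_risk_le_iSup_risk hT0 f P ρ ρ₀ hρ e)
  have hm : ∀ U, Measurable fun g : K => bregman f (ρ₀.conj U) (e.toFun (g • θ₀))
      * ENNReal.ofReal (unitaryConj (V.toFun g) P₀ * (ρ₀.conj U).val).trace.re := fun U =>
    ((measurable_bregman hf _ e).comp hc.measurable).mul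
      (ENNReal.measurable_ofReal.comp (Continuous.measurable (by fun_prop)))
  simp only [hP.risk_eq hc hf]
  rw [Finset.sum_congr rfl fun U _ => (lintegral_const_mul _ (hm U)).symm,
    ← lintegral_finsetSum _ fun U _ => (hm U).const_mul _]
  calc bayesRisk f T ρ₀ P₀ = ∫⁻ _ : K, bayesRisk f T ρ₀ P₀ ∂(haarProb K) := by simp
    _ ≤ _ := lintegral_mono fun g => ?_
  rw [← bayesRisk_unitaryConj hT f ρ₀ (V.toFun g) hP.1]
  refine bayesRisk_le hf hT0 ρ₀ (posSemidef_unitaryConj _ hP.1) ?_ _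
  rw [posteriorMean_unitaryConj hT, trace_unitaryConj, htr]

end Seed

/-! ### Lower bounds for arbitrary measurements -/

/-- Rounding down to multiples of `ε`, as a measurable map with countably many values. -/
theorem exists_countable_rounding {ε : ℝ} (hε : 0 < ε) :
    ∃ φ : ℝ≥0∞ → ℝ≥0∞, Measurable φ ∧ (Set.range φ).Countable ∧
      ∀ t, φ t ≤ t ∧ t ≤ φ t + ENNReal.ofReal ε := by
  classical
  refine ⟨fun t => if t = ⊤ then ⊤ else ENNReal.ofReal (ε * (⌊t.toReal / ε⌋₊ : ℝ)), ?_, ?_, ?_⟩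
  · refine Measurable.ite (measurableSet_singleton _) measurable_const ?_
    exact ENNReal.measurable_ofReal.comp (measurable_const.mul
      ((measurable_from_nat (f := fun k : ℕ => (k : ℝ))).comp
        (Nat.measurable_floor.comp (ENNReal.measurable_toReal.div_const ε))))
  · refine Set.Countable.mono ?_ ((Set.countable_singleton (⊤ : ℝ≥0∞)).union
      (Set.countable_range fun k : ℕ => ENNReal.ofReal (ε * (k : ℝ))))
    rintro _ ⟨t, rfl⟩
    by_cases ht : t = ⊤
    · left; simp [ht]
    · right; exact ⟨⌊t.toReal / ε⌋₊, by simp [ht]⟩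
  · intro t
    by_cases ht : t = ⊤
    · simp [ht]
    have h0 : 0 ≤ t.toReal / ε := div_nonneg ENNReal.toReal_nonneg hε.le
    have h1 := Nat.floor_le h0
    have h2 := Nat.lt_floor_add_one (t.toReal / ε)
    rw [le_div_iff₀ hε] at h1
    rw [div_lt_iff₀ hε] at h2
    simp only [ht, if_false]
    rw [← ENNReal.ofReal_add (by positivity) hε.le]
    refine ⟨ENNReal.ofReal_le_of_le_toReal (by linarith), ?_⟩
    exact (ENNReal.le_ofReal_iff_toReal_le ht (by positivity)).mpr (by linarith)

section Operator

variable {n : Type*} [Fintype n] [DecidableEq n] {X : Type*} [MeasurableSpace X]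

instance isProbabilityMeasure_born (Q : POVM X n) (ρ : DensityMatrix n) :
    IsProbabilityMeasure (born Q ρ) :=
  ⟨by rw [born_apply Q ρ MeasurableSet.univ, Q.total, one_mul, ρ.trace_eq_one]; simp⟩

/-- An operator inequality, valid at each outcome, may be integrated against a measurement. The
functions are rounded to countably many values, and the inequality is used on the effect of each of
the countably many sets on which all of them are constant. -/
theorem le_sum_lintegral_born (Q : POVM X n) {ι : Type*} (s : Finset ι) (ρ : ι → DensityMatrix n)
    (τ : DensityMatrix n) {g : ι → X → ℝ≥0∞} (hg : ∀ i, Measurable (g i)) (c : ℝ≥0∞)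
    (h : ∀ x, ∀ A : Matrix n n ℂ, A.PosSemidef → c * ENNReal.ofReal (A * τ.val).trace.re
      ≤ ∑ i ∈ s, g i x * ENNReal.ofReal (A * (ρ i).val).trace.re) :
    c ≤ ∑ i ∈ s, ∫⁻ x, g i x ∂(born Q (ρ i)) := by
  classical
  refine ENNReal.le_of_forall_pos_le_add fun δ hδ _ => ?_
  set ε : ℝ := δ / (s.card + 1) with hεdef
  have hε : 0 < ε := by positivity
  have hsε : (s.card : ℝ≥0∞) * ENNReal.ofReal ε ≤ δ := by
    rw [← ENNReal.ofReal_natCast, ← ENNReal.ofReal_mul (by positivity), ← ENNReal.ofReal_coe_nnreal]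
    refine ENNReal.ofReal_le_ofReal ?_
    rw [hεdef, mul_div_assoc', div_le_iff₀ (by positivity), mul_comm]
    have : (0 : ℝ) ≤ δ := δ.2
    nlinarith
  obtain ⟨φ, hφm, hφc, hφ⟩ := exists_countable_rounding hε
  -- `ψ` records the rounded values of all functions; `N` is its countable range.
  set ψ : X → s → ℝ≥0∞ := fun x i => φ (g i x) with hψ
  have hψm : Measurable ψ := measurable_pi_lambda _ fun i => hφm.comp (hg i)
  set N : Set (s → ℝ≥0∞) := {y | ∀ i, y i ∈ Set.range φ}
  have hN : N.Countable := Set.countable_pi fun _ => hφc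
  have : Countable N := hN.to_subtype
  set B : N → Set X := fun y => ψ ⁻¹' {y.1} with hB
  have hBm : ∀ y, MeasurableSet (B y) := fun y => hψm (measurableSet_singleton _)
  have hBd : Pairwise (Function.onFun Disjoint B) := fun y z hyz =>
    Disjoint.preimage _ (Set.disjoint_singleton.mpr fun h => hyz (Subtype.ext h))
  have hBu : ⋃ y, B y = Set.univ := by
    refine Set.eq_univ_of_forall fun x => Set.mem_iUnion.mpr ⟨⟨ψ x, fun i => ⟨g i x, rfl⟩⟩, rfl⟩
  have hlin : ∀ i : s, ∑' y : N, (y.1 i + ENNReal.ofReal ε) * born Q (ρ i) (B y)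
      ≤ (∫⁻ x, g i x ∂(born Q (ρ i))) + ENNReal.ofReal ε := by
    intro i
    have h1 : ∀ y : N, ∫⁻ x in B y, (φ (g i x) + ENNReal.ofReal ε) ∂(born Q (ρ i))
        = (y.1 i + ENNReal.ofReal ε) * born Q (ρ i) (B y) := by
      intro y
      rw [setLIntegral_congr_fun (g := fun _ => y.1 i + ENNReal.ofReal ε) (hBm y)
        fun x hx => ?_, setLIntegral_const]
      have : ψ x = y.1 := hx
      simp only [← this, hψ]
    simp only [← h1]
    rw [← lintegral_iUnion hBm hBd, hBu, Measure.restrict_univ]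
    calc ∫⁻ x, (φ (g i x) + ENNReal.ofReal ε) ∂(born Q (ρ i))
        ≤ ∫⁻ x, (g i x + ENNReal.ofReal ε) ∂(born Q (ρ i)) :=
          lintegral_mono fun x => by gcongr; exact (hφ _).1
      _ = _ := by rw [lintegral_add_right _ measurable_const]; simp
  have hpt : ∀ y : N, c * born Q τ (B y)
      ≤ ∑ i : s, (y.1 i + ENNReal.ofReal ε) * born Q (ρ i) (B y) := by
    intro y
    rcases (B y).eq_empty_or_nonempty with h0 | ⟨x, hx⟩
    · simp [h0]
    have h1 := h x (Q.meas (B y)) (Q.nonneg _ (hBm y))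
    rw [born_apply Q τ (hBm y)]
    refine h1.trans ?_
    rw [← Finset.sum_coe_sort s]
    refine Finset.sum_le_sum fun i _ => ?_
    rw [born_apply Q _ (hBm y)]
    gcongr
    have : ψ x = y.1 := hx
    rw [← this]
    exact (hφ _).2
  calc c = c * born Q τ (⋃ y, B y) := by rw [hBu, measure_univ, mul_one]
    _ = ∑' y, c * born Q τ (B y) := by rw [measure_iUnion hBd hBm, ENNReal.tsum_mul_left]
    _ ≤ ∑' y : N, ∑ i : s, (y.1 i + ENNReal.ofReal ε) * born Q (ρ i) (B y) :=
        ENNReal.tsum_le_tsum hpt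
    _ = ∑ i : s, ∑' y : N, (y.1 i + ENNReal.ofReal ε) * born Q (ρ i) (B y) :=
        Summable.tsum_finsetSum fun _ _ => ENNReal.summable
    _ ≤ ∑ i : s, ((∫⁻ x, g i x ∂(born Q (ρ i))) + ENNReal.ofReal ε) :=
        Finset.sum_le_sum fun i _ => hlin i
    _ = ∑ i ∈ s, ((∫⁻ x, g i x ∂(born Q (ρ i))) + ENNReal.ofReal ε) :=
        Finset.sum_coe_sort s fun i => (∫⁻ x, g i x ∂(born Q (ρ i))) + ENNReal.ofReal ε
    _ ≤ _ := by
        rw [Finset.sum_add_distrib, Finset.sum_const, nsmul_eq_mul]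
        gcongr

end Operator

/-! ### Pure states -/

section PureStates

variable {n : Type*} [Fintype n] [DecidableEq n]

theorem exists_unitaryConj_single (i j : n) :
    ∃ W : unitaryGroup n ℂ, unitaryConj W (single i i 1) = single j j 1 := by
  have hmem : (Equiv.swap i j).permMatrix ℂ ∈ unitaryGroup n ℂ := by
    rw [mem_unitaryGroup_iff, star_eq_conjTranspose, conjTranspose_permMatrix, ← permMatrix_mul]
    simp
  refine ⟨⟨_, hmem⟩, ?_⟩
  simp only [unitaryConj, conjTranspose_permMatrix, Equiv.Perm.permMatrix,
    PEquiv.toMatrix_toPEquiv_mul, PEquiv.mul_toMatrix_toPEquiv]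
  ext a b
  have h : ∀ c, i = Equiv.swap i j c ↔ j = c := fun c => by
    rw [eq_comm, Equiv.swap_apply_eq_iff, Equiv.swap_apply_left, eq_comm]
  simp [single_apply, h]

theorem unitaryConj_sum {ι : Type*} (U : unitaryGroup n ℂ) (s : Finset ι)
    (A : ι → Matrix n n ℂ) : unitaryConj U (∑ i ∈ s, A i) = ∑ i ∈ s, unitaryConj U (A i) := by
  simp only [unitaryConj, Finset.mul_sum, Finset.sum_mul]

theorem unitaryConj_smul (U : unitaryGroup n ℂ) (c : ℂ) (A : Matrix n n ℂ) :
    unitaryConj U (c • A) = c • unitaryConj U A := by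
  simp only [unitaryConj, Matrix.mul_smul, Matrix.smul_mul]

theorem exists_eq_sum_unitaryConj_single {A : Matrix n n ℂ} (hA : A.IsHermitian) :
    ∃ U : unitaryGroup n ℂ,
      A = ∑ k, (hA.eigenvalues k : ℂ) • unitaryConj U (single k k 1) := by
  refine ⟨hA.eigenvectorUnitary, ?_⟩
  have h := cfc_eq_mul_diagonal_mul hA (fun t => t)
  rw [cfc_id' ℝ A hA.isSelfAdjoint] at h
  change A = unitaryConj hA.eigenvectorUnitary _ at h
  conv_lhs => rw [h]
  simp only [← unitaryConj_smul, ← unitaryConj_sum]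
  congr 1
  ext a b
  rw [Matrix.sum_apply]
  rcases eq_or_ne a b with rfl | hab
  · simp [single_apply]
  · rw [diagonal_apply_ne _ hab]
    refine (Finset.sum_eq_zero fun k _ => ?_).symm
    have : ¬ (k = a ∧ k = b) := fun h => hab (h.1.symm.trans h.2)
    simp [this]

theorem PureState.exists_eq_unitaryConj_single (θ : PureState n) :
    ∃ (U : unitaryGroup n ℂ) (j : n), θ.val = unitaryConj U (single j j 1) := by
  obtain ⟨U, hU⟩ := exists_eq_sum_unitaryConj_single θ.isHermitian
  set μ := θ.isHermitian.eigenvalues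
  have hμ : ∀ k, μ k = 0 ∨ μ k = 1 := by
    intro k
    have h1 := θ.isHermitian.mulVec_eigenvectorBasis k
    have h2 : θ.val *ᵥ (θ.val *ᵥ (θ.isHermitian.eigenvectorBasis k : n → ℂ))
        = θ.val *ᵥ (θ.isHermitian.eigenvectorBasis k : n → ℂ) := by
      rw [mulVec_mulVec, θ.idem]
    have h3 : (θ.isHermitian.eigenvectorBasis k : n → ℂ) ≠ 0 := fun h0 =>
      θ.isHermitian.eigenvectorBasis.orthonormal.ne_zero k (by ext i; exact congrFun h0 i)
    simp only [h1, mulVec_smul, smul_smul] at h2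
    have h4 := smul_left_injective ℝ h3 h2
    have h5 : μ k * (μ k - 1) = 0 := by
      have : μ k * μ k = μ k := h4
      linarith
    exact (mul_eq_zero.mp h5).imp id sub_eq_zero.mp
  have hsum : ∑ k, μ k = 1 := by
    have := θ.isHermitian.trace_eq_sum_eigenvalues
    rw [θ.trace_eq_one] at this
    exact Complex.ofReal_injective (by simpa using this.symm)
  obtain ⟨j, hj⟩ : ∃ j, μ j = 1 := by
    by_contra! hne
    have : ∀ k, μ k = 0 := fun k => (hμ k).resolve_right (hne k)
    simp [this] at hsum
  have hz : ∀ k, k ≠ j → μ k = 0 := by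
    intro k hk
    have h1 : ∑ i ∈ Finset.univ.erase j, μ i = 0 := by
      rw [← Finset.add_sum_erase _ _ (Finset.mem_univ j), hj] at hsum
      linarith
    exact (Finset.sum_eq_zero_iff_of_nonneg fun i _ => by rcases hμ i with h | h <;> simp [h]).mp h1
      k (Finset.mem_erase.mpr ⟨hk, Finset.mem_univ k⟩)
  refine ⟨U, j, ?_⟩
  rw [hU, Finset.sum_eq_single j (fun k _ hk => by simp [hz k hk]) (by simp), hj]
  simp

/-- The unitary group acts transitively on the pure states. -/
theorem PureState.exists_unitaryConj_eq (θ η : PureState n) :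
    ∃ W : unitaryGroup n ℂ, unitaryConj W θ.val = η.val := by
  obtain ⟨U, i, hU⟩ := θ.exists_eq_unitaryConj_single
  obtain ⟨V, j, hV⟩ := η.exists_eq_unitaryConj_single
  obtain ⟨S, hS⟩ := exists_unitaryConj_single (n := n) i j
  refine ⟨V * S * U⁻¹, ?_⟩
  rw [hU, hV, ← unitaryConj_mul, inv_mul_cancel_right, unitaryConj_mul, hS]

theorem exists_eq_sum_unitaryConj_pure {A : Matrix n n ℂ} (hA : A.PosSemidef) (θ : PureState n) :
    ∃ (a : n → ℝ) (W : n → unitaryGroup n ℂ), (∀ k, 0 ≤ a k) ∧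
      A = ∑ k, (a k : ℂ) • unitaryConj (W k) θ.val := by
  obtain ⟨U, hU⟩ := exists_eq_sum_unitaryConj_single hA.1
  obtain ⟨V, i, hV⟩ := θ.exists_eq_unitaryConj_single
  choose S hS using fun k => exists_unitaryConj_single (n := n) i k
  refine ⟨_, fun k => U * S k * V⁻¹, hA.eigenvalues_nonneg, ?_⟩
  conv_lhs => rw [hU]
  refine Finset.sum_congr rfl fun k _ => ?_
  rw [hV, ← unitaryConj_mul, inv_mul_cancel_right, unitaryConj_mul, hS]

/-- The maximally mixed state. -/
noncomputable def maximallyMixed (n : Type*) [Fintype n] [DecidableEq n] [Nonempty n] :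
    DensityMatrix n where
  val := (Fintype.card n : ℂ)⁻¹ • 1
  posSemidef := PosSemidef.one.smul (inv_nonneg.mpr (by exact_mod_cast Nat.zero_le _))
  trace_eq_one := by simp

variable {T : Finset (unitaryGroup n ℂ)}

/-- No measurement whatsoever does better than one with a rank-one seed: every effect is a positive
combination of conjugates of the seed, and for each of these the posterior mean bound holds. -/
theorem bayesRisk_le_minimaxRisk_of_pure [Nonempty n] {f : ℝ → ℝ} (hf : IsBregmanGenerator f)
    (hT : MatchesHaarMoments T) (hT0 : T.Nonempty) (θ : PureState n) (ρ₀ : DensityMatrix n)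
    (htr : (posteriorMean T ρ₀ ((Fintype.card n : ℂ) • θ.val)).trace = 1) {X ι : Type*}
    [MeasurableSpace X] (Q : POVM X n) (ρ : ι → DensityMatrix n)
    (hρ : ∀ U ∈ T, ∃ i, ρ i = ρ₀.conj U) :
    bayesRisk f T ρ₀ ((Fintype.card n : ℂ) • θ.val) ≤ minimaxRisk f ρ Q := by
  have hd : (0 : ℝ) < Fintype.card n := by exact_mod_cast Fintype.card_pos
  set A₀ := (Fintype.card n : ℂ) • θ.val with hA₀
  have hpos : A₀.PosSemidef := θ.posSemidef.smul (by exact_mod_cast Nat.zero_le _)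
  refine le_iInf fun e => le_trans ?_ (sum_risk_le_iSup_risk hT0 f Q ρ ρ₀ hρ e)
  have hm : ∀ U, Measurable fun x => bregman f (ρ₀.conj U) (e.toFun x) := fun U =>
    measurable_bregman hf _ e
  have hrisk : ∀ U, (T.card : ℝ≥0∞)⁻¹ * risk f Q (ρ₀.conj U) e
      = ∫⁻ x, (T.card : ℝ≥0∞)⁻¹ * bregman f (ρ₀.conj U) (e.toFun x) ∂(born Q (ρ₀.conj U)) :=
    fun U => (lintegral_const_mul _ (hm U)).symm
  simp only [hrisk]
  refine le_sum_lintegral_born Q T (fun U => ρ₀.conj U) (maximallyMixed n)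
    (g := fun U x => (T.card : ℝ≥0∞)⁻¹ * bregman f (ρ₀.conj U) (e.toFun x))
    (fun U => (hm U).const_mul _) _ fun x A hA => ?_
  obtain ⟨a, W, ha, hAW⟩ := exists_eq_sum_unitaryConj_pure hA θ
  set b : n → ℝ := fun k => a k / Fintype.card n with hb
  have hb0 : ∀ k, 0 ≤ b k := fun k => div_nonneg (ha k) hd.le
  have hAb : A = ∑ k, (b k : ℂ) • unitaryConj (W k) A₀ := by
    rw [hAW]
    refine Finset.sum_congr rfl fun k _ => ?_
    rw [hA₀, unitaryConj_smul, smul_smul, hb]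
    have : (Fintype.card n : ℂ) ≠ 0 := by exact_mod_cast hd.ne'
    push_cast
    rw [div_mul_cancel₀ _ this]
  have htrA : ∀ σ : DensityMatrix n,
      ENNReal.ofReal (A * σ.val).trace.re
        = ∑ k, ENNReal.ofReal (b k) * ENNReal.ofReal (unitaryConj (W k) A₀ * σ.val).trace.re := by
    intro σ
    have h0 : ∀ k, 0 ≤ (unitaryConj (W k) A₀ * σ.val).trace.re := fun k =>
      trace_mul_nonneg (posSemidef_unitaryConj _ hpos) σ.posSemidef
    simp only [← ENNReal.ofReal_mul (hb0 _)]
    rw [← ENNReal.ofReal_sum_of_nonneg fun k _ => mul_nonneg (hb0 k) (h0 k), hAb, Finset.sum_mul,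
      trace_sum, Complex.re_sum]
    simp only [Matrix.smul_mul, trace_smul, smul_eq_mul, Complex.re_ofReal_mul]
  have hmix : ∀ k, (unitaryConj (W k) A₀ * (maximallyMixed n).val).trace.re = 1 := by
    intro k
    have : (Fintype.card n : ℂ) ≠ 0 := by exact_mod_cast hd.ne'
    simp [maximallyMixed, trace_unitaryConj, hA₀, θ.trace_eq_one, this]
  simp only [htrA, hmix, ENNReal.ofReal_one, mul_one, Finset.mul_sum]
  rw [Finset.sum_comm]
  refine Finset.sum_le_sum fun k _ => ?_
  have h1 := bayesRisk_le hf hT0 ρ₀ (posSemidef_unitaryConj (W k) hpos)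
    (by rw [posteriorMean_unitaryConj hT, trace_unitaryConj, htr]) (e.toFun x)
  rw [bayesRisk_unitaryConj hT f ρ₀ (W k) hpos] at h1
  calc bayesRisk f T ρ₀ A₀ * ENNReal.ofReal (b k)
      ≤ (∑ U ∈ T, (T.card : ℝ≥0∞)⁻¹ * (bregman f (ρ₀.conj U) (e.toFun x) * ENNReal.ofReal
        (unitaryConj (W k) A₀ * unitaryConj U ρ₀.val).trace.re)) * ENNReal.ofReal (b k) := by
        gcongr
    _ = _ := by
        rw [Finset.sum_mul]
        refine Finset.sum_congr rfl fun U _ => ?_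
        change _ = _ * (_ * ENNReal.ofReal (unitaryConj (W k) A₀ * unitaryConj U ρ₀.val).trace.re)
        ring

end PureStates

/-! ### Covariance, and restriction to a 2-design -/

section Covariance

variable {n : Type*} [Fintype n] [DecidableEq n] {K : Type*} [Group K] [TopologicalSpace K]

theorem unitaryConj_injective (U : unitaryGroup n ℂ) : Function.Injective (unitaryConj U) := by
  intro A B h
  have := congrArg (unitaryConj U⁻¹) h
  simpa only [← unitaryConj_mul, inv_mul_cancel, unitaryConj_one] using this

theorem ProjRep.unitaryConj_inv (V : ProjRep K n) (g : K) (A : Matrix n n ℂ) :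
    unitaryConj (V.toFun g⁻¹) A = unitaryConj (V.toFun g)⁻¹ A := by
  have h1 : ∀ B, unitaryConj (V.toFun 1) B = B := fun B => by
    have := V.unitaryConj_mul 1 1 B
    rw [mul_one] at this
    exact (unitaryConj_injective _ this).symm
  apply unitaryConj_injective (V.toFun g)
  rw [← V.unitaryConj_mul, mul_inv_cancel, h1, ← QEst.unitaryConj_mul, mul_inv_cancel,
    unitaryConj_one]

variable [IsTopologicalGroup K] [CompactSpace K] [MeasurableSpace K] [BorelSpace K] {Θ : Type*}
  [MulAction K Θ] [TopologicalSpace Θ] [T2Space Θ] [MeasurableSpace Θ] [BorelSpace Θ]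
  [ContinuousConstSMul K Θ] {V : ProjRep K n} {θ₀ : Θ} {P : POVM Θ n} {P₀ : Matrix n n ℂ}

/-- A measurement with a seed is covariant, as the Haar measure is left invariant. -/
theorem HasSeed.isCovariant (hP : HasSeed V θ₀ P P₀) (hc : Continuous fun g : K => g • θ₀) :
    IsCovariant V P := by
  intro h B hB
  have himg : (fun θ : Θ => h⁻¹ • θ) '' B = (fun θ => h • θ) ⁻¹' B := by
    ext θ
    constructor
    · rintro ⟨η, hη, rfl⟩
      simpa using hη
    · exact fun hθ => ⟨h • θ, hθ, by simp⟩
  have hB' : MeasurableSet ((fun θ : Θ => h • θ) ⁻¹' B) :=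
    (continuous_const_smul h).measurable hB
  set E := (fun g : K => g • θ₀) ⁻¹' B with hE
  have hEm : MeasurableSet E := hc.measurable hB
  have hcV := V.continuous_unitaryConj P₀
  rw [himg]
  ext i j
  have hlhs : ((V.toFun h : Matrix n n ℂ)ᴴ * P.meas B * (V.toFun h : Matrix n n ℂ)) i j
      = ∑ b, ∑ a, star ((V.toFun h : Matrix n n ℂ) a i) * P.meas B a b
        * (V.toFun h : Matrix n n ℂ) b j := by
    simp only [mul_apply, Finset.sum_mul, conjTranspose_apply]
  have hi : ∀ a b, Integrable (fun g => star ((V.toFun h : Matrix n n ℂ) a i)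
      * unitaryConj (V.toFun g) P₀ a b * (V.toFun h : Matrix n n ℂ) b j)
      ((haarProb K).restrict E) := fun a b =>
    (integrable_haarProb ((continuous_const.mul (hcV.matrix_elem a b)).mul
      continuous_const)).integrableOn
  calc _ = ∑ b, ∑ a, ∫ g in E, star ((V.toFun h : Matrix n n ℂ) a i)
        * unitaryConj (V.toFun g) P₀ a b * (V.toFun h : Matrix n n ℂ) b j ∂(haarProb K) := by
        rw [hlhs]
        simp only [hP.meas_apply hc hB, integral_mul_const, integral_const_mul, hE]
    _ = ∫ g in E, unitaryConj (V.toFun (h⁻¹ * g)) P₀ i j ∂(haarProb K) := by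
        rw [← Finset.sum_congr rfl fun b _ => integral_finsetSum _ fun a _ => hi a b,
          ← integral_finsetSum _ fun b _ => integrable_finsetSum _ fun a _ => hi a b]
        refine integral_congr_ae (Filter.Eventually.of_forall fun g => ?_)
        simp only
        rw [V.unitaryConj_mul, V.unitaryConj_inv]
        simp only [unitaryConj, UnitaryGroup.inv_val, star_eq_conjTranspose,
          conjTranspose_conjTranspose]
        rw [mul_apply]
        simp only [mul_apply (M := (V.toFun h : Matrix n n ℂ)ᴴ), Finset.sum_mul,
          conjTranspose_apply]
    _ = ∫ g, E.indicator (fun g => unitaryConj (V.toFun (h⁻¹ * g)) P₀ i j) g ∂(haarProb K) :=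
        (integral_indicator hEm).symm
    _ = ∫ g, E.indicator (fun g => unitaryConj (V.toFun (h⁻¹ * g)) P₀ i j) (h * g)
          ∂(haarProb K) :=
        (integral_mul_left_eq_self _ h).symm
    _ = ∫ g, ((fun g : K => g • θ₀) ⁻¹' ((fun θ : Θ => h • θ) ⁻¹' B)).indicator
          (fun g => unitaryConj (V.toFun g) P₀ i j) g ∂(haarProb K) := by
        refine integral_congr_ae (Filter.Eventually.of_forall fun g => ?_)
        have hiff : h * g ∈ E ↔ g ∈ (fun g : K => g • θ₀) ⁻¹' ((fun θ : Θ => h • θ) ⁻¹' B) := by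
          change (h * g) • θ₀ ∈ B ↔ h • g • θ₀ ∈ B
          rw [mul_smul]
        simp only
        by_cases hg : h * g ∈ E
        · rw [Set.indicator_of_mem hg, Set.indicator_of_mem (hiff.mp hg), inv_mul_cancel_left]
        · rw [Set.indicator_of_notMem hg, Set.indicator_of_notMem fun h' => hg (hiff.mpr h')]
    _ = _ := by
        rw [integral_indicator (hc.measurable hB'), hP.meas_apply hc hB']

end Covariance

section General

theorem isMinimax_of_le {X Θ n : Type*} [MeasurableSpace X] [Fintype n] [DecidableEq n]
    {f : ℝ → ℝ} {ρ : Θ → DensityMatrix n} {P : POVM X n}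
    (h : ∀ Q : POVM X n, minimaxRisk f ρ P ≤ minimaxRisk f ρ Q) : IsMinimax f ρ P :=
  le_antisymm (iInf_le _ P) (le_iInf h)

/-- The restriction of a minimax covariant measurement to a 2-design is minimax. Both measurements
have the same minimax risk, namely the Bayes risk for the uniform prior on the design. -/
theorem isMinimax_of_twoDesign {n : Type*} [Fintype n] [DecidableEq n]
    {G : Type*} [Group G] [TopologicalSpace G] [IsTopologicalGroup G] [CompactSpace G]
    [MeasurableSpace G] [BorelSpace G] {Θ : Type*} [TopologicalSpace Θ] [T2Space Θ]
    [MeasurableSpace Θ] [BorelSpace Θ] [MulAction G Θ] [ContinuousSMul G Θ]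
    [MulAction.IsPretransitive G Θ] {V : ProjRep G n} {θ₀ : Θ} {ρ : Θ → DensityMatrix n}
    (hρ : ∀ g : G, (ρ (g • θ₀)).val
      = (V.toFun g : Matrix n n ℂ) * (ρ θ₀).val * (V.toFun g : Matrix n n ℂ)ᴴ)
    {f : ℝ → ℝ} (hf : IsBregmanGenerator f) {P : POVM Θ n} {P₀ : Matrix n n ℂ}
    (hP : HasSeed V θ₀ P P₀) (hmin : IsMinimax f ρ P) {H : Subgroup G} [CompactSpace H]
    (hH : IsUnitaryTwoDesign {U | ∃ h ∈ H, V.toFun h = U}) {P' : POVM Θ n}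
    (hP' : HasSeed (V.restrict H) θ₀ P' P₀) : IsMinimax f ρ P' := by
  obtain ⟨T, hTS, hT⟩ := hH.exists_matchesHaarMoments
  have hmem : ∀ U, U ∈ T ↔ ∃ h ∈ H, V.toFun h = U := fun U => by
    rw [← Finset.mem_coe, hTS]; rfl
  have hT0 : T.Nonempty := ⟨V.toFun 1, (hmem _).mpr ⟨1, H.one_mem, rfl⟩⟩
  have hc : Continuous fun g : G => g • θ₀ := by fun_prop
  have hcH : Continuous fun h : H => h • θ₀ := by fun_prop
  have hTG : ∀ U ∈ T, ∃ g, V.toFun g = U := fun U hU => by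
    obtain ⟨h, -, rfl⟩ := (hmem U).mp hU
    exact ⟨h, rfl⟩
  have hTH : ∀ U ∈ T, ∃ h, (V.restrict H).toFun h = U := fun U hU => by
    obtain ⟨h, hh, rfl⟩ := (hmem U).mp hU
    exact ⟨⟨h, hh⟩, rfl⟩
  have hconj : ∀ g : G, ρ (g • θ₀) = (ρ θ₀).conj (V.toFun g) := fun g =>
    DensityMatrix.ext' (hρ g)
  have hle : minimaxRisk f ρ P' ≤ bayesRisk f T (ρ θ₀) P₀ :=
    hP'.minimaxRisk_le hcH hf hT hT0 hTH ρ (ρ θ₀) fun θ => by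
      obtain ⟨g, rfl⟩ := MulAction.exists_smul_eq G θ₀ θ
      exact ⟨_, hconj g⟩
  have hge : bayesRisk f T (ρ θ₀) P₀ ≤ minimaxRisk f ρ P :=
    hP.bayesRisk_le_minimaxRisk hc hf hT hT0 hTG ρ (ρ θ₀) fun U hU => by
      obtain ⟨g, rfl⟩ := hTG U hU
      exact ⟨_, hconj g⟩
  refine isMinimax_of_le fun Q => (hle.trans hge).trans ?_
  rw [← hmin]
  exact iInf_le _ Q

end General

/-! ### The space of pure states -/

section PureStateSpace

variable {n : Type*} [Fintype n]

theorem PureState.continuous_val : Continuous (PureState.val : PureState n → Matrix n n ℂ) :=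
  continuous_induced_dom

theorem PureState.val_injective : Function.Injective (PureState.val : PureState n → Matrix n n ℂ) :=
  fun _ _ => PureState.ext'

instance : T2Space (PureState n) :=
  .of_injective_continuous PureState.val_injective PureState.continuous_val

variable [DecidableEq n]

theorem PureState.val_smul (U : unitaryGroup n ℂ) (θ : PureState n) :
    (U • θ).val = unitaryConj U θ.val := rfl

instance : ContinuousSMul (unitaryGroup n ℂ) (PureState n) where
  continuous_smul := by
    refine continuous_induced_rng.mpr ?_
    change Continuous fun p : unitaryGroup n ℂ × PureState n =>
      (p.1 : Matrix n n ℂ) * p.2.val * (p.1 : Matrix n n ℂ)ᴴ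
    have h1 : Continuous fun p : unitaryGroup n ℂ × PureState n => p.2.val :=
      PureState.continuous_val.comp continuous_snd
    fun_prop

end PureStateSpace

/-! ### The octahedral group -/

/-- The eigenstates of the Pauli matrices, the vertices of an octahedron in the Bloch sphere. -/
def pauliStates : Set (PureState (Fin 2)) := Set.range fun p : Fin 3 × ℤˣ => pauliState p.1 p.2

theorem pauliStates_finite : pauliStates.Finite := Set.finite_range _

open scoped Pointwise in
/-- The binary octahedral group: the unitaries of determinant one which permute the six eigenstates
of the Pauli matrices. -/
def octahedralGroup : Subgroup (unitaryGroup (Fin 2) ℂ) :=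
  MulAction.stabilizer (unitaryGroup (Fin 2) ℂ) pauliStates
    ⊓ ((detMonoidHom (n := Fin 2) (R := ℂ)).comp (unitaryGroup (Fin 2) ℂ).subtype).ker

open scoped Pointwise in
theorem mem_octahedralGroup {U : unitaryGroup (Fin 2) ℂ} : U ∈ octahedralGroup ↔
    (∀ p : Fin 3 × ℤˣ, ∃ q : Fin 3 × ℤˣ, U • pauliState p.1 p.2 = pauliState q.1 q.2) ∧
      (U : Matrix (Fin 2) (Fin 2) ℂ).det = 1 := by
  rw [octahedralGroup, Subgroup.mem_inf,
    MulAction.mem_stabilizer_set_iff_smul_set_subset pauliStates_finite]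
  refine and_congr ⟨fun h p => ?_, fun h => ?_⟩ Iff.rfl
  · obtain ⟨q, hq⟩ := h ⟨_, ⟨p, rfl⟩, rfl⟩
    exact ⟨q, hq.symm⟩
  · rintro _ ⟨_, ⟨p, rfl⟩, rfl⟩
    obtain ⟨q, hq⟩ := h p
    exact ⟨q, hq.symm⟩

theorem smul_pauliState {U : unitaryGroup (Fin 2) ℂ} {k l : Fin 3} {t : ℤˣ}
    (h : (U : Matrix (Fin 2) (Fin 2) ℂ) * pauli k
      = ((t : ℤ) : ℂ) • pauli l * (U : Matrix (Fin 2) (Fin 2) ℂ)) (s : ℤˣ) :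
    U • pauliState k s = pauliState l (s * t) := by
  apply PureState.ext'
  have hU : (U : Matrix (Fin 2) (Fin 2) ℂ) * (U : Matrix (Fin 2) (Fin 2) ℂ)ᴴ = 1 :=
    mem_unitaryGroup_iff.mp U.2
  change (U : Matrix (Fin 2) (Fin 2) ℂ) * ((1 / 2 : ℂ) • (1 + ((s : ℤ) : ℂ) • pauli k))
    * (U : Matrix (Fin 2) (Fin 2) ℂ)ᴴ = (1 / 2 : ℂ) • (1 + (((s * t : ℤˣ) : ℤ) : ℂ) • pauli l)
  simp only [Matrix.mul_smul, Matrix.smul_mul, mul_add, add_mul, mul_one, h, hU]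
  rw [mul_assoc, hU, mul_one, smul_smul]
  push_cast
  rfl

/-- The rotation by `π` about the first axis. -/
noncomputable def flipX : unitaryGroup (Fin 2) ℂ :=
  ⟨!![0, Complex.I; Complex.I, 0], by
    rw [mem_unitaryGroup_iff]
    ext i j; fin_cases i <;> fin_cases j <;> simp [mul_apply, Fin.sum_univ_two]⟩

/-- The rotation by `π` about the third axis. -/
noncomputable def flipZ : unitaryGroup (Fin 2) ℂ :=
  ⟨!![Complex.I, 0; 0, -Complex.I], by
    rw [mem_unitaryGroup_iff]
    ext i j; fin_cases i <;> fin_cases j <;> simp [mul_apply, Fin.sum_univ_two]⟩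

/-- The rotation by `2π/3` which permutes the three axes cyclically. -/
noncomputable def cycleXYZ : unitaryGroup (Fin 2) ℂ :=
  ⟨(1 / 2 : ℂ) • !![1 - Complex.I, -1 - Complex.I; 1 - Complex.I, 1 + Complex.I], by
    rw [mem_unitaryGroup_iff]
    ext i j
    have h2 : (starRingEnd ℂ) 2 = 2 := map_ofNat _ 2
    fin_cases i <;> fin_cases j <;> simp [mul_apply, Fin.sum_univ_two, h2] <;> ring_nf <;>
      simp <;> norm_num⟩

theorem flipX_smul (k : Fin 3) (s : ℤˣ) :
    flipX • pauliState k s = pauliState k (s * ![1, -1, -1] k) := by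
  refine smul_pauliState ?_ s
  fin_cases k <;> (ext i j; fin_cases i <;> fin_cases j <;>
    simp [flipX, pauli, mul_apply, Fin.sum_univ_two])

theorem flipZ_smul (k : Fin 3) (s : ℤˣ) :
    flipZ • pauliState k s = pauliState k (s * ![-1, -1, 1] k) := by
  refine smul_pauliState ?_ s
  fin_cases k <;> (ext i j; fin_cases i <;> fin_cases j <;>
    simp [flipZ, pauli, mul_apply, Fin.sum_univ_two])

theorem cycleXYZ_smul (k : Fin 3) (s : ℤˣ) :
    cycleXYZ • pauliState k s = pauliState (k + 1) s := by
  conv_rhs => rw [← mul_one s]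
  refine smul_pauliState ?_ s
  fin_cases k <;> (ext i j; fin_cases i <;> fin_cases j <;>
    simp [cycleXYZ, pauli, mul_apply, Fin.sum_univ_two] <;> ring_nf <;> simp <;> ring)

theorem flipX_mem : flipX ∈ octahedralGroup :=
  mem_octahedralGroup.mpr ⟨fun p => ⟨(p.1, _), flipX_smul p.1 p.2⟩, by simp [flipX, det_fin_two]⟩

theorem flipZ_mem : flipZ ∈ octahedralGroup :=
  mem_octahedralGroup.mpr ⟨fun p => ⟨(p.1, _), flipZ_smul p.1 p.2⟩, by simp [flipZ, det_fin_two]⟩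

theorem cycleXYZ_mem : cycleXYZ ∈ octahedralGroup :=
  mem_octahedralGroup.mpr ⟨fun p => ⟨(p.1 + 1, p.2), cycleXYZ_smul p.1 p.2⟩, by
    simp [cycleXYZ, det_fin_two]; ring_nf; simp; norm_num⟩

/-- An element of the octahedral group is determined up to sign by the permutation of the six Pauli
eigenstates. -/
theorem finite_octahedralGroup : (octahedralGroup : Set (unitaryGroup (Fin 2) ℂ)).Finite := by
  refine Set.Finite.of_finite_fibers
    (fun U (p : Fin 3 × ℤˣ) => U • pauliState p.1 p.2) ?_ ?_
  · refine (Set.Finite.pi' fun _ : Fin 3 × ℤˣ => pauliStates_finite).subset ?_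
    rintro _ ⟨U, hU, rfl⟩ p
    obtain ⟨q, hq⟩ := (mem_octahedralGroup.mp hU).1 p
    exact ⟨q, hq.symm⟩
  · rintro _ ⟨U₀, hU₀, rfl⟩
    have hfin : {U : unitaryGroup (Fin 2) ℂ | (U : Matrix (Fin 2) (Fin 2) ℂ) ∈
        ({(U₀ : Matrix (Fin 2) (Fin 2) ℂ), -(U₀ : Matrix (Fin 2) (Fin 2) ℂ)} : Set _)}.Finite :=
      Set.Finite.preimage Subtype.val_injective.injOn (Set.toFinite _)
    refine hfin.subset ?_
    rintro U ⟨hU, hfib⟩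
    set A := (U : Matrix (Fin 2) (Fin 2) ℂ) with hA
    set A₀ := (U₀ : Matrix (Fin 2) (Fin 2) ℂ) with hA₀
    have h0 : A₀ᴴ * A₀ = 1 := mem_unitaryGroup_iff'.mp U₀.2
    have h0' : A₀ * A₀ᴴ = 1 := mem_unitaryGroup_iff.mp U₀.2
    have h1 : Aᴴ * A = 1 := mem_unitaryGroup_iff'.mp U.2
    -- `U₀† U` commutes with two of the Pauli matrices, hence is a scalar.
    set W := A₀ᴴ * A with hW
    have hcomm : ∀ p : Fin 3 × ℤˣ, W * (pauliState p.1 p.2).val = (pauliState p.1 p.2).val * W := by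
      intro p
      have h2 : A * (pauliState p.1 p.2).val * Aᴴ = A₀ * (pauliState p.1 p.2).val * A₀ᴴ :=
        congrArg PureState.val (congrFun hfib p)
      calc W * (pauliState p.1 p.2).val
          = A₀ᴴ * (A * (pauliState p.1 p.2).val * Aᴴ) * A := by
            rw [hW]; simp only [mul_assoc, h1, mul_one]
        _ = (A₀ᴴ * A₀) * (pauliState p.1 p.2).val * W := by
            rw [h2, hW]; simp only [mul_assoc]
        _ = _ := by rw [h0, one_mul]
    have hz := hcomm (2, 1)
    have hx := hcomm (0, 1)
    have e1 := congrFun (congrFun hz 0) 1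
    have e2 := congrFun (congrFun hz 1) 0
    have e3 := congrFun (congrFun hx 0) 1
    simp [pauliState, pauli, mul_apply, Fin.sum_univ_two] at e1 e2 e3
    have hdet : W.det = 1 := by
      rw [hW, det_mul, det_conjTranspose, (mem_octahedralGroup.mp hU₀).2,
        (mem_octahedralGroup.mp hU).2]
      simp
    have e4 : W 0 0 = W 1 1 := by linear_combination 2 * e3
    rw [det_fin_two, e4] at hdet
    have hWs : W = W 1 1 • (1 : Matrix (Fin 2) (Fin 2) ℂ) := by
      ext i j
      fin_cases i <;> fin_cases j
      · simp [e4]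
      · simp [e1]
      · simp [e2]
      · simp
    have hAW : A = W 1 1 • A₀ := by
      rw [← mul_one A₀, ← Matrix.mul_smul, ← hWs, hW, ← mul_assoc, h0', one_mul]
    have hsq : W 1 1 = 1 ∨ W 1 1 = -1 := mul_self_eq_one_iff.mp (by rw [← hdet, e1]; ring)
    rcases hsq with h | h
    · exact Or.inl (by rw [← hA, hAW, h, one_smul])
    · exact Or.inr (by rw [← hA, hAW, h, neg_one_smul]; rfl)

instance : Finite octahedralGroup := finite_octahedralGroup

theorem pauliState_injective :
    Function.Injective fun p : Fin 3 × ℤˣ => pauliState p.1 p.2 := by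
  rintro ⟨k, s⟩ ⟨l, t⟩ h
  have hv : (1 / 2 : ℂ) • (1 + ((s : ℤ) : ℂ) • pauli k)
      = (1 / 2 : ℂ) • (1 + ((t : ℤ) : ℂ) • pauli l) := congrArg PureState.val h
  have e1 := congrFun (congrFun hv 0) 0
  have e2 := congrFun (congrFun hv 0) 1
  have e3 := congrFun (congrFun hv 1) 0
  rcases Int.units_eq_one_or s with rfl | rfl <;> rcases Int.units_eq_one_or t with rfl | rfl <;>
    fin_cases k <;> fin_cases l <;>
    simp [pauli, Complex.ext_iff] at e1 e2 e3 ⊢ <;>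
    norm_num at e2

/-- The octahedral group acts transitively on the six Pauli eigenstates. -/
theorem exists_smul_eq_pauliState (p : Fin 3 × ℤˣ) :
    ∃ U ∈ octahedralGroup, U • pauliState 2 1 = pauliState p.1 p.2 := by
  obtain ⟨k, s⟩ := p
  have h2 : ∃ U ∈ octahedralGroup, U • pauliState 2 1 = pauliState 2 s := by
    rcases Int.units_eq_one_or s with rfl | rfl
    · exact ⟨1, octahedralGroup.one_mem, one_smul _ _⟩
    · exact ⟨flipX, flipX_mem, flipX_smul 2 1⟩
  have hstep : ∀ k : Fin 3, (∃ U ∈ octahedralGroup, U • pauliState 2 1 = pauliState k s) →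
      ∃ U ∈ octahedralGroup, U • pauliState 2 1 = pauliState (k + 1) s := by
    rintro k ⟨U, hU, h⟩
    exact ⟨cycleXYZ * U, octahedralGroup.mul_mem cycleXYZ_mem hU, by
      rw [mul_smul, h, cycleXYZ_smul]⟩
  have h0 := hstep 2 h2
  have h1 := hstep 0 h0
  fin_cases k
  exacts [h0, h1, h2]

/-! ### The octahedral group is a unitary 2-design -/

/-- The matrix `U ⊗ U`. -/
def tensorSquare (U : unitaryGroup (Fin 2) ℂ) : Matrix (Fin 2 × Fin 2) (Fin 2 × Fin 2) ℂ :=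
  (U : Matrix (Fin 2) (Fin 2) ℂ) ⊗ₖ (U : Matrix (Fin 2) (Fin 2) ℂ)

theorem tensorSquare_mul (U W : unitaryGroup (Fin 2) ℂ) :
    tensorSquare (U * W) = tensorSquare U * tensorSquare W := by
  rw [tensorSquare, Submonoid.coe_mul, mul_kronecker_mul]
  rfl

theorem tensorSquare_mul_conjTranspose (U : unitaryGroup (Fin 2) ℂ) :
    tensorSquare U * (tensorSquare U)ᴴ = 1 := by
  have hU : (U : Matrix (Fin 2) (Fin 2) ℂ) * (U : Matrix (Fin 2) (Fin 2) ℂ)ᴴ = 1 :=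
    mem_unitaryGroup_iff.mp U.2
  rw [tensorSquare, conjTranspose_kronecker, ← mul_kronecker_mul, hU, one_kronecker_one]

/-- The operator which exchanges the two tensor factors. -/
def swapOperator : Matrix (Fin 2 × Fin 2) (Fin 2 × Fin 2) ℂ :=
  (1 : Matrix (Fin 2 × Fin 2) (Fin 2 × Fin 2) ℂ).submatrix Prod.swap id

theorem tensorSquare_mul_swap (U : unitaryGroup (Fin 2) ℂ) :
    tensorSquare U * swapOperator = swapOperator * tensorSquare U := by
  ext ⟨a, b⟩ ⟨c, d⟩
  fin_cases a <;> fin_cases b <;> fin_cases c <;> fin_cases d <;>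
    simp [tensorSquare, swapOperator, mul_apply, Fintype.sum_prod_type, Fin.sum_univ_two,
      kroneckerMap_apply, one_apply] <;> ring

/-- An operator which commutes with `U ⊗ U` for the rotations `flipX`, `flipZ` and `cycleXYZ` is a
combination of the identity and the swap operator. The relations for the two flips, `eX` and `eZ`,
are sign and reflection symmetries of the entries; two of the relations for `cycleXYZ` suffice. -/
theorem exists_eq_add_swap {M : Matrix (Fin 2 × Fin 2) (Fin 2 × Fin 2) ℂ}
    (hX : tensorSquare flipX * M = M * tensorSquare flipX)
    (hZ : tensorSquare flipZ * M = M * tensorSquare flipZ)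
    (hC : tensorSquare cycleXYZ * M = M * tensorSquare cycleXYZ) :
    ∃ r t : ℂ, M = r • (1 : Matrix (Fin 2 × Fin 2) (Fin 2 × Fin 2) ℂ) + t • swapOperator := by
  have eX := fun a b => congrFun (congrFun hX a) b
  have eZ := fun a b => congrFun (congrFun hZ a) b
  simp [tensorSquare, mul_apply, Fintype.sum_prod_type, Fin.sum_univ_two,
    kroneckerMap_apply, Prod.forall, Fin.forall_fin_two, flipX, flipZ] at eX eZ
  have c1 := congrFun (congrFun hC (0, 0)) (0, 1)
  have c2 := congrFun (congrFun hC (0, 1)) (0, 0)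
  simp [tensorSquare, mul_apply, Fintype.sum_prod_type, Fin.sum_univ_two,
    kroneckerMap_apply, cycleXYZ] at c1 c2
  obtain ⟨⟨⟨⟨w1, -⟩, -, w2⟩, ⟨-, x1⟩, x2, -⟩, -⟩ := eX
  simp only [neg_eq_self, self_eq_neg] at eZ
  obtain ⟨⟨⟨z1, z2⟩, z3, z4⟩, ⟨z5, z6⟩, z7, z8⟩ := eZ
  have hI : Complex.I * Complex.I = -1 := Complex.I_mul_I
  -- Up to the symmetries in `eX`, the entries left over by `eZ` are `x`, `y`, `p` and `q`.
  set x := M (0, 1) (0, 1)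
  set y := M (0, 1) (1, 0)
  set p := M (0, 0) (0, 0)
  set q := M (0, 0) (1, 1)
  rw [z1, z2, z7, x1] at c1
  rw [z3, z4, z5, w1] at c2
  have h1 : x + y = p - q := by
    linear_combination (-2) * c1 + (x + y - p + q) / 2 * hI
  have h2 : p + q = x + y := by
    linear_combination (2 * Complex.I) * c2
      + ((p + q - x - y) - Complex.I / 2 * (p - x - y - q)) * hI
  have hq : q = 0 := by linear_combination (h2 + h1) / 2
  have hp : p = x + y := by linear_combination h2 - hq
  refine ⟨x, y, ?_⟩
  ext ⟨a, b⟩ ⟨c, d⟩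
  fin_cases a <;> fin_cases b <;> fin_cases c <;> fin_cases d <;>
    simp [swapOperator, one_apply, z1, z2, z3, z4, z5, z6, z7, z8, w1, w2, x1, x2, hq, hp] <;>
    first | exact hp | exact hq | rfl

/-- The average over the octahedral group commutes with `U ⊗ U` for `U` in the group, so it is a
combination of the identity and the swap operator and commutes with `U ⊗ U` for all unitaries. By
invariance of the Haar measure it is then the average over the unitary group. -/
theorem isUnitaryTwoDesign_octahedralGroup :
    IsUnitaryTwoDesign (octahedralGroup : Set (unitaryGroup (Fin 2) ℂ)) := by
  set T := finite_octahedralGroup.toFinset with hTdef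
  have hmem : ∀ U, U ∈ T ↔ U ∈ octahedralGroup := fun U => by simp [hTdef]
  have hc0 : (T.card : ℂ) ≠ 0 := by
    exact_mod_cast (Finset.card_pos.mpr ⟨1, (hmem 1).mpr octahedralGroup.one_mem⟩).ne'
  refine ⟨T, finite_octahedralGroup.coe_toFinset, fun ρ a b => ?_⟩
  set τ : unitaryGroup (Fin 2) ℂ → Matrix (Fin 2 × Fin 2) (Fin 2 × Fin 2) ℂ →
    Matrix (Fin 2 × Fin 2) (Fin 2 × Fin 2) ℂ := fun U X =>
      tensorSquare U * X * (tensorSquare U)ᴴ with hτ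
  change (T.card : ℂ)⁻¹ * ∑ U ∈ T, τ U ρ.val a b = ∫ U, τ U ρ.val a b ∂(haarProb _)
  have hτmul : ∀ U W X, τ (U * W) X = τ U (τ W X) := fun U W X => by
    simp only [hτ, tensorSquare_mul, conjTranspose_mul, mul_assoc]
  have hcont : ∀ X, Continuous fun U => τ U X := continuous_kronecker_conj
  set S : Matrix (Fin 2 × Fin 2) (Fin 2 × Fin 2) ℂ := ∑ U ∈ T, τ U ρ.val with hS
  have hinv : ∀ W ∈ octahedralGroup, τ W S = S := by
    intro W hW
    have h1 : τ W S = ∑ U ∈ T, τ (W * U) ρ.val := by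
      simp only [hτmul, hS]
      simp only [hτ, Finset.mul_sum, Finset.sum_mul]
    rw [h1]
    refine Finset.sum_bij' (fun U _ => W * U) (fun U _ => W⁻¹ * U) ?_ ?_ ?_ ?_ ?_
    · exact fun U hU => (hmem _).mpr (octahedralGroup.mul_mem hW ((hmem U).mp hU))
    · exact fun U hU => (hmem _).mpr
        (octahedralGroup.mul_mem (octahedralGroup.inv_mem hW) ((hmem U).mp hU))
    · exact fun U _ => inv_mul_cancel_left W U
    · exact fun U _ => mul_inv_cancel_left W U
    · exact fun U _ => rfl
  have hcomm : ∀ W ∈ octahedralGroup, tensorSquare W * S = S * tensorSquare W := by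
    intro W hW
    conv_rhs => rw [← hinv W hW]
    have h1 : (tensorSquare W)ᴴ * tensorSquare W = 1 :=
      mul_eq_one_comm.mp (tensorSquare_mul_conjTranspose W)
    simp only [hτ, mul_assoc, h1, mul_one]
  obtain ⟨r, t, hrt⟩ := exists_eq_add_swap (hcomm _ flipX_mem) (hcomm _ flipZ_mem)
    (hcomm _ cycleXYZ_mem)
  have hfix : ∀ W, τ W S = S := by
    intro W
    have h1 : tensorSquare W * S = S * tensorSquare W := by
      rw [hrt, mul_add, add_mul, Matrix.mul_smul, Matrix.mul_smul, Matrix.smul_mul,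
        Matrix.smul_mul, mul_one, one_mul, tensorSquare_mul_swap]
    simp only [hτ]
    rw [h1, mul_assoc, tensorSquare_mul_conjTranspose, mul_one]
  -- Averaging over the unitary group absorbs an average over the octahedral group.
  have hright : ∀ W ∈ T, ∫ U, τ U (τ W ρ.val) a b ∂(haarProb _)
      = ∫ U, τ U ρ.val a b ∂(haarProb (unitaryGroup (Fin 2) ℂ)) := by
    intro W _
    simp only [← hτmul]
    exact integral_mul_right_eq_self (fun U => τ U ρ.val a b) W
  have hsum : ∀ U, ∑ W ∈ T, τ U (τ W ρ.val) a b = S a b := by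
    intro U
    rw [← hfix U, hS]
    simp only [hτ, Finset.mul_sum, Finset.sum_mul, Matrix.sum_apply]
  rw [inv_mul_eq_iff_eq_mul₀ hc0, ← nsmul_eq_mul, ← Finset.sum_const, ← Finset.sum_congr rfl hright,
    ← integral_finsetSum _ fun W _ => integrable_haarProb ((hcont _).matrix_elem a b)]
  simp only [hsum, integral_const, probReal_univ, one_smul]
  rw [hS, Matrix.sum_apply]

/-! ### The Pauli measurement -/

theorem orbitMeasure_singleton_smul {K Θ : Type*} [Group K] [TopologicalSpace K]
    [IsTopologicalGroup K] [CompactSpace K] [MeasurableSpace K] [BorelSpace K] [MulAction K Θ]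
    [TopologicalSpace Θ] [T1Space Θ] [MeasurableSpace Θ] [BorelSpace Θ] {θ₀ : Θ}
    (hc : Continuous fun g : K => g • θ₀) (h : K) (θ : Θ) :
    orbitMeasure K θ₀ {h • θ} = orbitMeasure K θ₀ {θ} := by
  rw [orbitMeasure, Measure.map_apply hc.measurable (measurableSet_singleton _),
    Measure.map_apply hc.measurable (measurableSet_singleton _),
    ← measure_preimage_mul (haarProb K) h]
  congr 1
  ext g
  simp [mul_smul]

theorem continuous_octahedralGroup_smul (θ : PureState (Fin 2)) :
    Continuous fun g : octahedralGroup => g • θ :=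
  continuous_subtype_val.smul continuous_const

/-- The orbit measure of the octahedral group is the uniform distribution on the six Pauli
eigenstates. -/
theorem integral_orbitMeasure_octahedralGroup {E : Type*} [NormedAddCommGroup E] [NormedSpace ℝ E]
    [CompleteSpace E] (F : PureState (Fin 2) → E) :
    ∫ θ, F θ ∂(orbitMeasure octahedralGroup (pauliState 2 1))
      = ∑ p : Fin 3 × ℤˣ, (6⁻¹ : ℝ) • F (pauliState p.1 p.2) := by
  classical
  set ν := orbitMeasure octahedralGroup (pauliState 2 1) with hν
  have hc := continuous_octahedralGroup_smul (pauliState 2 1)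
  have : IsProbabilityMeasure ν := Measure.isProbabilityMeasure_map hc.aemeasurable
  set S : Finset (PureState (Fin 2)) :=
    Finset.univ.map ⟨fun p : Fin 3 × ℤˣ => pauliState p.1 p.2, pauliState_injective⟩ with hS
  have hae : ∀ᵐ θ ∂ν, θ ∈ (S : Set (PureState (Fin 2))) := by
    refine (ae_map_iff hc.aemeasurable S.measurableSet).mpr
      (Filter.Eventually.of_forall fun g => ?_)
    obtain ⟨q, hq⟩ := (mem_octahedralGroup.mp g.2).1 (2, 1)
    exact Finset.mem_map.mpr ⟨q, Finset.mem_univ q, hq.symm⟩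
  have hconst : ∀ p : Fin 3 × ℤˣ, ν {pauliState p.1 p.2} = ν {pauliState 2 1} := by
    intro p
    obtain ⟨U, hU, h⟩ := exists_smul_eq_pauliState p
    rw [← h]
    exact orbitMeasure_singleton_smul hc (⟨U, hU⟩ : octahedralGroup) _
  have hone : 6 * ν.real {pauliState 2 1} = 1 := by
    have h1 : ν S = 1 := by
      rw [← measure_univ (μ := ν)]
      refine measure_congr ?_
      filter_upwards [hae] with θ hθ
      exact propext ⟨fun _ => trivial, fun _ => hθ⟩
    rw [← sum_measure_singleton, hS, Finset.sum_map] at h1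
    simp only [Function.Embedding.coeFn_mk, hconst, Finset.sum_const, nsmul_eq_mul] at h1
    have h2 := congrArg ENNReal.toReal h1
    simpa [Fintype.card_prod, Measure.real] using h2
  have hreal : ∀ p : Fin 3 × ℤˣ, ν.real {pauliState p.1 p.2} = 6⁻¹ := fun p => by
    rw [Measure.real, hconst, ← Measure.real]; linarith
  rw [← Measure.restrict_eq_self_of_ae_mem hae, setIntegral_finset, hS, Finset.sum_map]
  · simp only [Function.Embedding.coeFn_mk, hreal]
  · exact IntegrableOn.finset

theorem pauliPOVM_apply {B : Set (PureState (Fin 2))} (hB : MeasurableSet B) (i j : Fin 2) :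
    pauliPOVM.meas B i j = ∑ p : Fin 3 × ℤˣ,
      B.indicator (fun θ => (1 / 3 : ℂ) * θ.val i j) (pauliState p.1 p.2) := by
  rw [Fintype.sum_prod_type]
  simp only [pauliPOVM, FunLike.coe_sum, Finset.sum_apply, Matrix.sum_apply]
  refine Finset.sum_congr rfl fun k _ => Finset.sum_congr rfl fun s _ => ?_
  by_cases h : pauliState k s ∈ B
  · rw [VectorMeasure.dirac_apply_of_mem hB h, Set.indicator_of_mem h]
    rfl
  · rw [VectorMeasure.dirac_apply_of_notMem h, Set.indicator_of_notMem h]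
    rfl

theorem posSemidef_two_smul (θ : PureState (Fin 2)) : ((2 : ℂ) • θ.val).PosSemidef :=
  θ.posSemidef.smul zero_le_two

theorem hasSeed_pauliPOVM : HasSeed ((stdRep (Fin 2)).restrict octahedralGroup) (pauliState 2 1)
    pauliPOVM ((2 : ℂ) • (pauliState 2 1).val) := by
  refine ⟨posSemidef_two_smul _, fun θ => (2 : ℂ) • θ.val, fun g => ?_, fun B hB i j => ?_⟩
  · change (2 : ℂ) • ((g : unitaryGroup (Fin 2) ℂ) • pauliState 2 1).val
      = unitaryConj (g : unitaryGroup (Fin 2) ℂ) ((2 : ℂ) • (pauliState 2 1).val)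
    rw [unitaryConj_smul, PureState.val_smul]
  · rw [pauliPOVM_apply hB, ← integral_indicator hB, integral_orbitMeasure_octahedralGroup]
    refine Finset.sum_congr rfl fun p _ => ?_
    by_cases h : pauliState p.1 p.2 ∈ B
    · rw [Set.indicator_of_mem h, Set.indicator_of_mem h]
      change (1 / 3 : ℂ) * _ = (6⁻¹ : ℝ) • ((2 : ℂ) * _)
      rw [Complex.real_smul]
      push_cast
      ring
    · rw [Set.indicator_of_notMem h, Set.indicator_of_notMem h, smul_zero]

/-! ### The covariant measurement of a pure qubit state -/

/-- The law of a random pure state, distributed according to Haar measure. -/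
noncomputable abbrev blochMeasure : Measure (PureState (Fin 2)) :=
  orbitMeasure (unitaryGroup (Fin 2) ℂ) (pauliState 2 1)

theorem continuous_unitary_smul (θ : PureState (Fin 2)) :
    Continuous fun U : unitaryGroup (Fin 2) ℂ => U • θ := continuous_id.smul continuous_const

theorem integrable_val_blochMeasure (c : ℂ) (i j : Fin 2) :
    Integrable (fun θ : PureState (Fin 2) => c * θ.val i j) blochMeasure := by
  have hm : Continuous fun θ : PureState (Fin 2) => c * θ.val i j :=
    continuous_const.mul (PureState.continuous_val.matrix_elem i j)
  rw [blochMeasure, orbitMeasure, integrable_map_measure hm.measurable.aestronglyMeasurable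
    (continuous_unitary_smul _).aemeasurable]
  exact integrable_haarProb (hm.comp (continuous_unitary_smul _))

/-- The matrix-valued measure `B ↦ ∫_B 2θ dθ`. -/
noncomputable def blochVectorMeasure :
    VectorMeasure (PureState (Fin 2)) (Matrix (Fin 2) (Fin 2) ℂ) :=
  ∑ i, ∑ j, (blochMeasure.withDensityᵥ fun θ => 2 * θ.val i j).mapRange
    (singleLinearMap ℂ i j).toAddMonoidHom
    (by
      change Continuous fun c : ℂ => Matrix.single i j c
      refine continuous_matrix fun a b => ?_
      by_cases h : i = a ∧ j = b <;> simp [single, h] <;> fun_prop)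

theorem blochVectorMeasure_apply {B : Set (PureState (Fin 2))} (hB : MeasurableSet B)
    (i j : Fin 2) : blochVectorMeasure B i j = ∫ θ in B, 2 * θ.val i j ∂blochMeasure := by
  simp only [blochVectorMeasure, FunLike.coe_sum, Finset.sum_apply, VectorMeasure.mapRange_apply,
    withDensityᵥ_apply (integrable_val_blochMeasure 2 _ _) hB, LinearMap.toAddMonoidHom_coe,
    singleLinearMap_apply]
  exact congrFun (congrFun (matrix_eq_sum_single
    (Matrix.of fun i j => ∫ θ in B, 2 * θ.val i j ∂blochMeasure)).symm i) j

theorem posSemidef_blochVectorMeasure {B : Set (PureState (Fin 2))} (hB : MeasurableSet B) :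
    (blochVectorMeasure B).PosSemidef := by
  have hi : ∀ i j, Integrable (fun θ : PureState (Fin 2) => 2 * θ.val i j)
      (blochMeasure.restrict B) := fun i j => (integrable_val_blochMeasure 2 i j).integrableOn
  refine .of_dotProduct_mulVec_nonneg ?_ fun x => ?_
  · ext i j
    rw [conjTranspose_apply, blochVectorMeasure_apply hB, blochVectorMeasure_apply hB,
      Complex.star_def, ← integral_conj]
    refine integral_congr_ae (Filter.Eventually.of_forall fun θ => ?_)
    have := congrFun (congrFun θ.isHermitian i) j
    rw [conjTranspose_apply, Complex.star_def] at this
    change (starRingEnd ℂ) (2 * θ.val j i) = 2 * θ.val i j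
    rw [map_mul, this, map_ofNat]
  · have h1 : star x ⬝ᵥ blochVectorMeasure B *ᵥ x
        = ∫ θ in B, star x ⬝ᵥ ((2 : ℂ) • θ.val) *ᵥ x ∂blochMeasure := by
      simp only [dotProduct, mulVec, blochVectorMeasure_apply hB, Matrix.smul_apply, smul_eq_mul]
      rw [integral_finsetSum]
      · refine Finset.sum_congr rfl fun i _ => ?_
        rw [integral_const_mul, integral_finsetSum]
        · simp only [integral_mul_const]
        · exact fun j _ => (hi i j).mul_const _
      · exact fun i _ => (integrable_finsetSum _ fun j _ => (hi i j).mul_const _).const_mul _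
    rw [h1]
    exact integral_nonneg fun θ => (posSemidef_two_smul θ).dotProduct_mulVec_nonneg x

/-- The total mass is fixed by conjugation with `flipX` and `flipZ`, hence scalar, and has
trace two. -/
theorem blochVectorMeasure_univ : blochVectorMeasure Set.univ = 1 := by
  have happ : ∀ i j, blochVectorMeasure Set.univ i j
      = ∫ U, 2 * unitaryConj U (pauliState 2 1).val i j ∂(haarProb (unitaryGroup (Fin 2) ℂ)) := by
    intro i j
    have hm : Continuous fun θ : PureState (Fin 2) => 2 * θ.val i j :=
      continuous_const.mul (PureState.continuous_val.matrix_elem i j)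
    rw [blochVectorMeasure_apply MeasurableSet.univ, setIntegral_univ, blochMeasure, orbitMeasure, integral_map
      (continuous_unitary_smul _).aemeasurable hm.measurable.aestronglyMeasurable]
    rfl
  have hinv : ∀ W : unitaryGroup (Fin 2) ℂ, ∀ i j, blochVectorMeasure Set.univ i j
      = ∫ U, 2 * unitaryConj (W * U) (pauliState 2 1).val i j
        ∂(haarProb (unitaryGroup (Fin 2) ℂ)) := by
    intro W i j
    rw [happ]
    exact (integral_mul_left_eq_self
      (fun U => 2 * unitaryConj U (pauliState 2 1).val i j) W).symm
  have hint : ∀ i j, Integrable (fun U => 2 * unitaryConj U (pauliState 2 1).val i j)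
      (haarProb (unitaryGroup (Fin 2) ℂ)) := fun i j =>
    integrable_haarProb (continuous_const.mul ((continuous_unitaryConj _).matrix_elem i j))
  -- Conjugation by `flipZ` changes the sign of the off-diagonal entries, and conjugation by `flipX`
  -- exchanges the diagonal entries.
  have hZ : ∀ A, unitaryConj flipZ A 0 1 = -A 0 1 ∧ unitaryConj flipZ A 1 0 = -A 1 0 := by
    intro A
    simp only [unitaryConj, mul_apply, Fin.sum_univ_two, conjTranspose_apply]
    simp [flipZ]
    constructor <;> linear_combination A _ _ * Complex.I_mul_I
  have hX : ∀ A, unitaryConj flipX A 0 0 = A 1 1 := by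
    intro A
    simp only [unitaryConj, mul_apply, Fin.sum_univ_two, conjTranspose_apply]
    simp [flipX]
    linear_combination -A _ _ * Complex.I_mul_I
  have h01 := hinv flipZ 0 1
  have h10 := hinv flipZ 1 0
  have h00 := hinv flipX 0 0
  simp only [unitaryConj_mul, (hZ _).1, (hZ _).2, hX, mul_neg, integral_neg, ← happ] at h01 h10 h00
  have htr : blochVectorMeasure Set.univ 0 0 + blochVectorMeasure Set.univ 1 1 = 2 := by
    rw [happ, happ, ← integral_add (hint 0 0) (hint 1 1)]
    have : ∀ U, 2 * unitaryConj U (pauliState 2 1).val 0 0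
        + 2 * unitaryConj U (pauliState 2 1).val 1 1 = 2 := by
      intro U
      rw [← mul_add, ← trace_fin_two, trace_unitaryConj, PureState.trace_eq_one, mul_one]
    simp [this]
  ext i j
  fin_cases i <;> fin_cases j
  · simp; linear_combination (htr + h00) / 2
  · simp; linear_combination h01 / 2
  · simp; linear_combination h10 / 2
  · simp; linear_combination (htr - h00) / 2

/-- The covariant measurement of a qubit, with density `2θ` with respect to the invariant
probability measure on the pure states. -/
noncomputable def blochPOVM : POVM (PureState (Fin 2)) (Fin 2) where
  meas := blochVectorMeasure
  nonneg _ hB := posSemidef_blochVectorMeasure hB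
  total := blochVectorMeasure_univ

theorem hasSeed_blochPOVM : HasSeed (stdRep (Fin 2)) (pauliState 2 1) blochPOVM
    ((2 : ℂ) • (pauliState 2 1).val) := by
  refine ⟨posSemidef_two_smul _, fun θ => (2 : ℂ) • θ.val, fun g => ?_, fun B hB i j => ?_⟩
  · change (2 : ℂ) • (g • pauliState 2 1).val = unitaryConj g ((2 : ℂ) • (pauliState 2 1).val)
    rw [unitaryConj_smul, PureState.val_smul]
  · exact blochVectorMeasure_apply hB i j

/-! ### Minimax measurements of pure states -/

/-- A rank-one seed makes a measurement minimax: its minimax risk is the Bayes risk for the uniform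
prior on a 2-design, which no other measurement can beat. -/
theorem HasSeed.isMinimax_toDensity {n K : Type*} [Fintype n] [DecidableEq n] [Nonempty n] [Group K]
    [TopologicalSpace K] [IsTopologicalGroup K] [CompactSpace K] [MeasurableSpace K] [BorelSpace K]
    [MulAction K (PureState n)] {V : ProjRep K n} {θ₀ : PureState n}
    {P : POVM (PureState n) n} (hP : HasSeed V θ₀ P ((Fintype.card n : ℂ) • θ₀.val))
    (hc : Continuous fun g : K => g • θ₀) {f : ℝ → ℝ} (hf : IsBregmanGenerator f)
    {T : Finset (unitaryGroup n ℂ)} (hT : MatchesHaarMoments T) (hT0 : T.Nonempty)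
    (hTV : ∀ U ∈ T, ∃ h, V.toFun h = U) : IsMinimax f PureState.toDensity P := by
  refine isMinimax_of_le fun Q => (hP.minimaxRisk_le hc hf hT hT0 hTV _ θ₀.toDensity ?_).trans
    (bayesRisk_le_minimaxRisk_of_pure hf hT hT0 θ₀ θ₀.toDensity
      (hP.trace_posteriorMean hc hT hT0 hTV _) Q _ fun U _ => ⟨U • θ₀, rfl⟩)
  intro θ
  obtain ⟨W, hW⟩ := θ₀.exists_unitaryConj_eq θ
  exact ⟨W, DensityMatrix.ext' hW.symm⟩

end QEst

theorem mainTheorem4 :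
    -- the general statement
    (∀ (n : Type*) [Fintype n] [DecidableEq n]
        -- the compact group `G`, acting continuously and transitively on the parameter space `Θ`
        (G : Type*) [Group G] [TopologicalSpace G] [IsTopologicalGroup G] [CompactSpace G]
        [MeasurableSpace G] [BorelSpace G]
        (Θ : Type*) [TopologicalSpace Θ] [CompactSpace Θ] [TopologicalSpace.MetrizableSpace Θ]
        [MeasurableSpace Θ] [BorelSpace Θ]
        [MulAction G Θ] [ContinuousSMul G Θ] [MulAction.IsPretransitive G Θ]
        -- the projective representation and the orbit of states
        (V : QEst.ProjRep G n) (θ₀ : Θ) (ρ : Θ → QEst.DensityMatrix n)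
        (_hρ : ∀ g : G, (ρ (g • θ₀)).val
          = (V.toFun g : Matrix n n ℂ) * (ρ θ₀).val * (V.toFun g : Matrix n n ℂ)ᴴ)
        -- the loss function
        (f : ℝ → ℝ) (_hf : QEst.IsBregmanGenerator f)
        -- a minimax covariant measurement with seed `P₀`
        (P : QEst.POVM Θ n) (P₀ : Matrix n n ℂ)
        (_hPcov : QEst.IsCovariant V P) (_hPseed : QEst.HasSeed V θ₀ P P₀)
        (_hPmin : QEst.IsMinimax f ρ P)
        -- a measurement with the same seed, covariant under `H`, where `{V_h}` is a 2-design
        (H : Subgroup G) [CompactSpace H]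
        (_hH : QEst.IsUnitaryTwoDesign {U | ∃ h ∈ H, V.toFun h = U})
        (P' : QEst.POVM Θ n)
        (_hP'cov : QEst.IsCovariant (V.restrict H) P')
        (_hP'seed : QEst.HasSeed (V.restrict H) θ₀ P' P₀),
      QEst.IsMinimax f ρ P') ∧
    -- the Pauli measurement, for the estimation of pure qubit states, is an instance
    (∃ (H : Subgroup (unitaryGroup (Fin 2) ℂ)) (_ : Finite H)
        (P : QEst.POVM (QEst.PureState (Fin 2)) (Fin 2)),
      QEst.IsUnitaryTwoDesign (H : Set (unitaryGroup (Fin 2) ℂ)) ∧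
      QEst.IsCovariant (QEst.stdRep (Fin 2)) P ∧
      QEst.IsCovariant ((QEst.stdRep (Fin 2)).restrict H) QEst.pauliPOVM ∧
      QEst.HasSeed (QEst.stdRep (Fin 2)) (QEst.pauliState 2 1) P
        ((2 : ℂ) • (QEst.pauliState 2 1).val) ∧
      QEst.HasSeed ((QEst.stdRep (Fin 2)).restrict H) (QEst.pauliState 2 1) QEst.pauliPOVM
        ((2 : ℂ) • (QEst.pauliState 2 1).val) ∧
      ∀ f : ℝ → ℝ, QEst.IsBregmanGenerator f →
        QEst.IsMinimax f QEst.PureState.toDensity P ∧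
        QEst.IsMinimax f QEst.PureState.toDensity QEst.pauliPOVM) := by
  refine ⟨?_, QEst.octahedralGroup, inferInstance, QEst.blochPOVM,
    QEst.isUnitaryTwoDesign_octahedralGroup,
    QEst.hasSeed_blochPOVM.isCovariant (QEst.continuous_unitary_smul _),
    QEst.hasSeed_pauliPOVM.isCovariant (QEst.continuous_octahedralGroup_smul _),
    QEst.hasSeed_blochPOVM, QEst.hasSeed_pauliPOVM, fun f hf => ?_⟩
  · intro n _ _ G _ _ _ _ _ _ Θ _ _ _ _ _ _ _ _ V θ₀ ρ hρ f hf P P₀ _ hP hmin H _ hH P' _ hP'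
    exact QEst.isMinimax_of_twoDesign hρ hf hP hmin hH hP'
  · obtain ⟨T, hTS, hT⟩ := QEst.isUnitaryTwoDesign_octahedralGroup.exists_matchesHaarMoments
    have hmem : ∀ U, U ∈ T ↔ U ∈ QEst.octahedralGroup := fun U => by
      rw [← Finset.mem_coe, hTS]; rfl
    have hT0 : T.Nonempty := ⟨1, (hmem 1).mpr QEst.octahedralGroup.one_mem⟩
    have hd : (2 : ℂ) = (Fintype.card (Fin 2) : ℂ) := by simp
    have hbloch := QEst.hasSeed_blochPOVM
    have hpauli := QEst.hasSeed_pauliPOVM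
    rw [hd] at hbloch hpauli
    exact ⟨hbloch.isMinimax_toDensity (QEst.continuous_unitary_smul _) hf hT hT0
        fun U _ => ⟨U, rfl⟩,
      hpauli.isMinimax_toDensity (QEst.continuous_octahedralGroup_smul _) hf hT hT0
        fun U hU => ⟨⟨U, (hmem U).mp hU⟩, rfl⟩⟩
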